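/- Let $n\ge 1$, $N\ge 0$ be integers. An N-function is a convex, left-continuous $\varphi:[0,\infty)\to[0,\infty)$ with $\varphi(0)=0$, $\lim_{t\to0}\varphi(t)/t=0$ and $\lim_{t\to\infty}\varphi(t)/t=\infty$. Let $\varphi$ be an N-function that is strictly convex, i.e. $\varphi(\frac{s+t}{2})<\frac{\varphi(s)+\varphi(t)}{2}$ for all $0\le s<t$, and whose Simonenko indices $$p=\inf_{t>0}\frac{\varphi'(t)\,t}{\varphi(t)},\qquad q=\sup_{t>0}\frac{\varphi'(t)\,t}{\varphi(t)}$$ (with $\varphi'$ the right derivative) satisfy $1\le p\le q<\infty$. Let $\Omega\subset\mathbb R^n$ be a bounded domain (open and connected) with Lipschitz boundary. Let $L^\varphi(\Omega)$ be the space of locally integrable functions $v$ on $\Omega$ with $\int_\Omega\varphi(|v|/\lambda)\,dx<\infty$ for some $\lambda>0$, with the Luxemburg norm $\|v\|_{L^\varphi}=\inf\{\lambda>0:\int_\Omega\varphi(|v|/\lambda)\,dx\le1\}$; let $W^{1,\varphi}(\Omega,\mathbb R^N)$ be the space of $v\in L^\varphi$ whose weak gradient lies in $L^\varphi$, with norm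 $\|v\|_{L^\varphi}+\|\nabla v\|_{L^\varphi}$ (with $|\nabla v|$ the Frobenius norm); and let $W^{1,\varphi}_0(\Omega,\mathbb R^N)$ be the closure of $C_c^\infty(\Omega,\mathbb R^N)$ in it. Let $u_D\in W^{1,\varphi}(\Omega,\mathbb R^N)$ and let $u$ minimize $$\mathcal J_\varphi(v)=\int_\Omega\varphi(|\nabla v|)\,dx$$ over all $v\in u_D+W^{1,\varphi}_0(\Omega,\mathbb R^N)$. On $\partial\Omega$ let $u$ denote its trace, i.e. the function in $L^1(\partial\Omega,\mathcal H^{n-1})$ that is the limit in $L^1(\partial\Omega,\mathcal H^{n-1})$ of the restrictions to $\partial\Omega$ of functions $v_k\in C^\infty(\mathbb R^n,\mathbb R^N)$ with $v_k\to u$ in $W^{1,1}(\Omega)$. Define the closed convex hull of the boundary values of $u$ by $$\overline{\mathrm{conv}}\,u(\partial\Omega)=\bigcap\{K\subset\mathbb R^N\text{ convex, closed}: u(x)\in K\text{ for }\mathcal H^{n-1}\text{-almost all }x\in\partial\Omega\}.$$ Then $$u(x)\in\overline{\mathrm{conv}}\,u(\partial\Omega)\qquad\text{for almost all }x\in\Omega.$$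 As a consequence, $\|u\|_{L^\infty(\Omega)}\le\|u\|_{L^\infty(\partial\Omega)}$, where $L^\infty(\partial\Omega)$ is taken with respect to $\mathcal H^{n-1}$ and the right-hand side may be $\infty$. -/

import Mathlib

open MeasureTheory Set Filter Topology
open scoped ENNReal NNReal ContDiff

noncomputable section

namespace OrliczSobolev

/-- Euclidean space `ℝⁿ` (with the Euclidean norm). -/
abbrev Vec (n : ℕ) := EuclideanSpace ℝ (Fin n)

/-- `n × N` matrices with the Frobenius norm, stored by rows: for a gradient `A = ∇u`, the row
`A i : ℝᴺ` is the partial derivative `∂ᵢu`. -/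
abbrev Grad (n N : ℕ) := PiLp 2 (fun _ : Fin n => Vec N)

/-! ### N-functions -/

/-- N-functions `φ : [0,∞) → [0,∞)`. Only the values of `φ` on `[0,∞)` matter. -/
structure IsNFunction (φ : ℝ → ℝ) : Prop where
  nonneg : ∀ t, 0 ≤ t → 0 ≤ φ t
  convexOn : ConvexOn ℝ (Ici 0) φ
  leftCont : ∀ t, 0 < t → ContinuousWithinAt φ (Iic t) t
  map_zero : φ 0 = 0
  tendsto_zero : Tendsto (fun t => φ t / t) (𝓝[>] 0) (𝓝 0)
  tendsto_atTop : Tendsto (fun t => φ t / t) atTop atTop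

/-- Strict convexity on `[0,∞)`, in midpoint form. -/
def IsStrictlyConvex (φ : ℝ → ℝ) : Prop :=
  ∀ s t : ℝ, 0 ≤ s → s < t → φ ((s + t) / 2) < (φ s + φ t) / 2

/-- The right derivative of `φ`. -/
def rightDeriv (φ : ℝ → ℝ) (t : ℝ) : ℝ := derivWithin φ (Ioi t) t

/-- Lower Simonenko index `inf_{t > 0} φ'(t) t / φ(t)`. -/
def lowerSimonenkoIndex (φ : ℝ → ℝ) : ℝ≥0∞ :=
  ⨅ (t : ℝ) (_ : 0 < t), ENNReal.ofReal (rightDeriv φ t * t / φ t)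

/-- Upper Simonenko index `sup_{t > 0} φ'(t) t / φ(t)`. -/
def upperSimonenkoIndex (φ : ℝ → ℝ) : ℝ≥0∞ :=
  ⨆ (t : ℝ) (_ : 0 < t), ENNReal.ofReal (rightDeriv φ t * t / φ t)

/-! ### Orlicz spaces -/

/-- The modular `∫_Ω φ(|v|) dx`, as an extended nonnegative number. -/
def modular {n : ℕ} {F : Type*} [NormedAddCommGroup F]
    (φ : ℝ → ℝ) (Ω : Set (Vec n)) (v : Vec n → F) : ℝ≥0∞ :=
  ∫⁻ x in Ω, ENNReal.ofReal (φ ‖v x‖)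

/-- `v ∈ L^φ(Ω, F)`. -/
def MemOrlicz {n : ℕ} {F : Type*} [NormedAddCommGroup F] [NormedSpace ℝ F]
    (φ : ℝ → ℝ) (Ω : Set (Vec n)) (v : Vec n → F) : Prop :=
  LocallyIntegrableOn v Ω ∧ ∃ l : ℝ, 0 < l ∧ modular φ Ω (fun x => l⁻¹ • v x) < ⊤

/-- The Luxemburg norm, equal to `⊤` if there is no admissible `l`. -/
def luxemburgNorm {n : ℕ} {F : Type*} [NormedAddCommGroup F] [NormedSpace ℝ F]
    (φ : ℝ → ℝ) (Ω : Set (Vec n)) (v : Vec n → F) : ℝ≥0∞ :=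
  ⨅ (l : ℝ) (_ : 0 < l ∧ modular φ Ω (fun x => l⁻¹ • v x) ≤ 1), ENNReal.ofReal l

/-! ### Weak gradients and Orlicz-Sobolev spaces -/

/-- The classical gradient, `(∇v)ᵢ = ∂ᵢv`. -/
def classicalGrad {n N : ℕ} (v : Vec n → Vec N) (x : Vec n) : Grad n N :=
  WithLp.toLp 2 fun i => fderiv ℝ v x (EuclideanSpace.single i 1)

/-- `G` is a weak gradient of `u` on the open set `Ω`. -/
def HasWeakGrad {n N : ℕ} (Ω : Set (Vec n)) (u : Vec n → Vec N) (G : Vec n → Grad n N) : Prop :=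
  LocallyIntegrableOn u Ω ∧ LocallyIntegrableOn G Ω ∧
    ∀ ψ : Vec n → ℝ, ContDiff ℝ ∞ ψ → HasCompactSupport ψ → tsupport ψ ⊆ Ω → ∀ i : Fin n,
      ∫ x in Ω, fderiv ℝ ψ x (EuclideanSpace.single i 1) • u x = -∫ x in Ω, ψ x • G x i

open Classical in
/-- The weak gradient of `u` on `Ω` (unique up to null sets of `Ω`); `0` if there is none. -/
def weakGrad {n N : ℕ} (Ω : Set (Vec n)) (u : Vec n → Vec N) : Vec n → Grad n N :=
  if h : ∃ G, HasWeakGrad Ω u G then h.choose else 0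

/-- `u ∈ W^{1,φ}(Ω, ℝᴺ)`. -/
def MemW {n N : ℕ} (φ : ℝ → ℝ) (Ω : Set (Vec n)) (u : Vec n → Vec N) : Prop :=
  (∃ G, HasWeakGrad Ω u G) ∧ MemOrlicz φ Ω u ∧ MemOrlicz φ Ω (weakGrad Ω u)

/-- The norm of `W^{1,φ}(Ω, ℝᴺ)`. -/
def sobolevNorm {n N : ℕ} (φ : ℝ → ℝ) (Ω : Set (Vec n)) (u : Vec n → Vec N) : ℝ≥0∞ :=
  luxemburgNorm φ Ω u + luxemburgNorm φ Ω (weakGrad Ω u)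

/-- `u ∈ W₀^{1,φ}(Ω, ℝᴺ)`, the closure of `C_c^∞(Ω, ℝᴺ)` in `W^{1,φ}(Ω, ℝᴺ)`. -/
def MemWZero {n N : ℕ} (φ : ℝ → ℝ) (Ω : Set (Vec n)) (u : Vec n → Vec N) : Prop :=
  MemW φ Ω u ∧ ∀ ε : ℝ≥0∞, 0 < ε → ∃ ψ : Vec n → Vec N,
    ContDiff ℝ ∞ ψ ∧ HasCompactSupport ψ ∧ tsupport ψ ⊆ Ω ∧
      sobolevNorm φ Ω (fun x => u x - ψ x) < ε

/-! ### Energy and minimizers -/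

/-- The energy `∫_Ω φ(|∇v|) dx`. -/
def energy {n N : ℕ} (φ : ℝ → ℝ) (Ω : Set (Vec n)) (v : Vec n → Vec N) : ℝ≥0∞ :=
  modular φ Ω (weakGrad Ω v)

/-- `u` minimizes the energy over `uD + W₀^{1,φ}(Ω, ℝᴺ)`. -/
def IsHarmonicWithBoundaryValues {n N : ℕ} (φ : ℝ → ℝ) (Ω : Set (Vec n))
    (uD u : Vec n → Vec N) : Prop :=
  MemWZero φ Ω (fun x => u x - uD x) ∧
    ∀ v : Vec n → Vec N, MemWZero φ Ω (fun x => v x - uD x) → energy φ Ω u ≤ energy φ Ω v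

/-! ### Lipschitz domains, boundary measure, traces -/

/-- Bounded domains with Lipschitz boundary: near each boundary point, after choosing a unit
vector `e` as the vertical direction, `Ω` is the strict supergraph of a Lipschitz function of the
horizontal part `y - ⟪e, y⟫ e` of `y`. -/
structure IsBoundedLipschitzDomain {n : ℕ} (Ω : Set (Vec n)) : Prop where
  isOpen : IsOpen Ω
  isConnected : IsConnected Ω
  isBounded : Bornology.IsBounded Ω
  lipschitz : ∀ x₀ ∈ frontier Ω, ∃ r : ℝ, 0 < r ∧ ∃ e : Vec n, ‖e‖ = 1 ∧
    ∃ (L : ℝ≥0) (γ : Vec n → ℝ), LipschitzWith L γ ∧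
      ∀ y ∈ Metric.ball x₀ r, y ∈ Ω ↔ γ (y - inner ℝ e y • e) < inner ℝ e y

/-- The `(n-1)`-dimensional Hausdorff measure on `∂Ω`. -/
def boundaryMeasure {n : ℕ} (Ω : Set (Vec n)) : Measure (Vec n) :=
  (Measure.hausdorffMeasure ((n : ℝ) - 1)).restrict (frontier Ω)

/-- `g` is the trace (the boundary values) of `u ∈ W^{1,1}(Ω, ℝᴺ)`: it lies in
`L¹(∂Ω, H^{n-1})`, and there are functions smooth up to the boundary which converge to `u` in
`W^{1,1}(Ω)` and whose restrictions to `∂Ω` converge to `g` in `L¹(∂Ω, H^{n-1})`. -/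
def IsTrace {n N : ℕ} (Ω : Set (Vec n)) (u g : Vec n → Vec N) : Prop :=
  MemLp g 1 (boundaryMeasure Ω) ∧
    ∃ G : Vec n → Grad n N, HasWeakGrad Ω u G ∧
      ∃ v : ℕ → Vec n → Vec N, (∀ k, ContDiff ℝ ∞ (v k)) ∧
        Tendsto (fun k => eLpNorm (fun x => v k x - u x) 1 (volume.restrict Ω)) atTop (𝓝 0) ∧
        Tendsto (fun k => eLpNorm (fun x => classicalGrad (v k) x - G x) 1 (volume.restrict Ω))
          atTop (𝓝 0) ∧
        Tendsto (fun k => eLpNorm (fun x => v k x - g x) 1 (boundaryMeasure Ω)) atTop (𝓝 0)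

/-- The closed convex hull of the boundary values `g` on `∂Ω`: the intersection of all closed
convex sets which contain `g(x)` for `H^{n-1}`-almost all `x ∈ ∂Ω`. -/
def boundaryConvexHull {n N : ℕ} (Ω : Set (Vec n)) (g : Vec n → Vec N) : Set (Vec N) :=
  ⋂₀ {K : Set (Vec N) | Convex ℝ K ∧ IsClosed K ∧ ∀ᵐ x ∂(boundaryMeasure Ω), g x ∈ K}

end OrliczSobolev

end

namespace OrliczSobolev

/-! Projecting towards a half-space does not increase the energy. Let `⟪a, g⟫ ≤ c` almost everywhere
on the boundary, with `|a| = 1`, and let `b > c`. Take a smooth `θ` that vanishes exactly on `(-∞,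
0]` with `0 ≤ θ' ≤ 1`, and compare `u` with `u - F`, where `F = θ(⟪a, u⟫ - b) a`. If `T` is the
gradient of `F`, then `|∇u - T|² + |T|² ≤ |∇u|²` pointwise (`norm_sub_truncationGrad_sq_add_le`).
Minimality and strict monotonicity of `φ` therefore force `T = 0`. Extended by zero, `F` is a
function on `ℝⁿ` with zero gradient and bounded support, so `F = 0`, that is, `⟪a, u⟫ ≤ b` almost
everywhere in `Ω`. Hahn-Banach and a countable choice of half-spaces turn this into the statement on
the convex hull; a closed ball as convex set gives the bound on the norms.

Two facts make `u - F` an admissible competitor. First, `F` extended by zero is weakly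
differentiable across `∂Ω` (`integral_truncation_eq_zero`). For the smooth approximations `v_k` of
`u`, the function `θ(⟪a, v_k⟫ - b)` vanishes near every boundary point outside the set `⟪a, v_k⟫ ≥
b`. That set has small Hausdorff measure by Chebyshev, hence a small projection along each
coordinate axis. On the lines that avoid it the fundamental theorem of calculus leaves no boundary
term; the remaining lines fill a cylinder of vanishing volume.

Second, such a zero extension lies in `W₀^{1,φ}` (`IsZeroExtension.isApproximable`): localize, push
the support into `Ω` along the vertical direction of the Lipschitz graph, and mollify. The finite
upper index makes `φ` doubling (`IsNFunction.doubling`), so finite modulars stay finite under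
scaling and translations are continuous in the modular. -/

/-- A Young function on `ℝ` (only its values on `[0,∞)` matter) with the doubling property. -/
structure IsDoublingYoung (Φ : ℝ → ℝ) : Prop where
  convexOn : ConvexOn ℝ univ Φ
  monotone : Monotone Φ
  map_zero : Φ 0 = 0
  doubling : ∃ C : ℝ, ∀ t, 0 ≤ t → Φ (2 * t) ≤ C * Φ t

/-- The modular `∫ Φ(l |f|) dμ`. -/
noncomputable def scaledModular {X E : Type*} [MeasurableSpace X] [NormedAddCommGroup E]
    (Φ : ℝ → ℝ) (μ : Measure X) (l : ℝ) (f : X → E) : ℝ≥0∞ :=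
  ∫⁻ x, ENNReal.ofReal (Φ (l * ‖f x‖)) ∂μ

/-! ### N-functions with finite upper index are doubling -/

section NFunction

variable {φ : ℝ → ℝ}

lemma IsNFunction.pos (hφ : IsNFunction φ) (hφc : IsStrictlyConvex φ) {t : ℝ} (ht : 0 < t) :
    0 < φ t := by
  have h1 := hφc 0 t le_rfl ht
  have h2 := hφ.nonneg ((0 + t) / 2) (by positivity)
  rw [hφ.map_zero] at h1
  linarith

lemma IsNFunction.strictMonoOn (hφ : IsNFunction φ) (hφc : IsStrictlyConvex φ) :
    StrictMonoOn φ (Ici 0) := by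
  intro s hs t ht hst
  have hs : 0 ≤ s := hs
  have ht0 : 0 < t := lt_of_le_of_lt hs hst
  have h := hφ.convexOn.2 (mem_Ici.2 le_rfl) (mem_Ici.2 ht0.le)
    (show 0 ≤ 1 - s / t by rw [sub_nonneg, div_le_one ht0]; exact hst.le)
    (show 0 ≤ s / t by positivity) (by ring)
  simp only [smul_eq_mul, mul_zero, zero_add, hφ.map_zero, div_mul_cancel₀ _ ht0.ne'] at h
  have : s / t < 1 := (div_lt_one ht0).2 hst
  nlinarith [hφ.pos hφc ht0]

lemma IsNFunction.rightDeriv_mul_le (hφ : IsNFunction φ) (hφc : IsStrictlyConvex φ)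
    (hq : upperSimonenkoIndex φ < ⊤) {t : ℝ} (ht : 0 < t) :
    rightDeriv φ t * t ≤ (upperSimonenkoIndex φ).toReal * φ t := by
  have h : ENNReal.ofReal (rightDeriv φ t * t / φ t) ≤ upperSimonenkoIndex φ :=
    le_iSup₂ (f := fun (t : ℝ) (_ : 0 < t) => ENNReal.ofReal (rightDeriv φ t * t / φ t)) t ht
  rw [← ENNReal.ofReal_toReal hq.ne, ENNReal.ofReal_le_ofReal_iff ENNReal.toReal_nonneg] at h
  rwa [div_le_iff₀ (hφ.pos hφc ht)] at h

lemma IsNFunction.sub_le_rightDeriv_mul (hφ : IsNFunction φ) {s t : ℝ} (ht : 0 ≤ t) (hts : t < s) :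
    φ s - φ t ≤ rightDeriv φ s * (s - t) := by
  have hs : s ∈ interior (Ici (0 : ℝ)) := by
    rw [interior_Ici]; exact lt_of_le_of_lt ht hts
  have h1 := hφ.convexOn.slope_le_leftDeriv_of_mem_interior (mem_Ici.2 ht) hs hts
  have h2 := hφ.convexOn.leftDeriv_le_rightDeriv_of_mem_interior hs
  have h3 := h1.trans h2
  rw [slope_def_field, div_le_iff₀ (by linarith)] at h3
  exact h3

/-- By convexity, `φ(s) - φ(rs) ≤ φ'(s)(1 - r)s`, and the index bounds `φ'(s)s` by `q φ(s)`. For `r`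
close to `1` this gives `φ(s) ≤ 2 φ(rs)`, which is iterated until `r^k < 1/2`. -/
lemma IsNFunction.doubling (hφ : IsNFunction φ) (hφc : IsStrictlyConvex φ)
    (hq : upperSimonenkoIndex φ < ⊤) : ∃ C : ℝ, ∀ t, 0 ≤ t → φ (2 * t) ≤ C * φ t := by
  -- Adding `1` ensures `q ≥ 1`, hence `0 < r < 1` below; `r` is chosen so that `q(1 - r) = 1/2`.
  set q := (upperSimonenkoIndex φ).toReal + 1
  have hq1 : 1 ≤ q := by simp [q]
  set r := 1 - 1 / (2 * q) with hr
  have hr0 : 0 < r := by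
    rw [hr, sub_pos, div_lt_one (by positivity)]; linarith
  have hr1 : r < 1 := by rw [hr]; simp; linarith
  have step : ∀ s, 0 ≤ s → φ s ≤ 2 * φ (r * s) := by
    intro s hs
    rcases hs.eq_or_lt with rfl | hs
    · simp [hφ.map_zero]
    have h1 := hφ.sub_le_rightDeriv_mul (mul_pos hr0 hs).le (by nlinarith : r * s < s)
    have h2 := hφ.rightDeriv_mul_le hφc hq hs
    have h3 : rightDeriv φ s * (s - r * s) = rightDeriv φ s * s * (1 / (2 * q)) := by
      rw [hr]; ring
    have h4 : rightDeriv φ s * s ≤ q * φ s := by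
      have := hφ.pos hφc hs
      simp only [q]; linarith
    have h5 : rightDeriv φ s * s * (1 / (2 * q)) ≤ q * φ s * (1 / (2 * q)) := by gcongr
    have h6 : q * φ s * (1 / (2 * q)) = φ s / 2 := by field_simp
    linarith
  have iter : ∀ (k : ℕ) (s : ℝ), 0 ≤ s → φ s ≤ 2 ^ k * φ (r ^ k * s) := by
    intro k
    induction k with
    | zero => intro s _; simp
    | succ k ih =>
      intro s hs
      refine (ih s hs).trans ?_
      have := step (r ^ k * s) (by positivity)
      rw [pow_succ, mul_assoc, pow_succ, mul_right_comm, mul_comm _ r]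
      gcongr
  obtain ⟨k, hk⟩ := exists_pow_lt_of_lt_one (by norm_num : (0 : ℝ) < 1 / 2) hr1
  refine ⟨2 ^ k, fun t ht => (iter k (2 * t) (by positivity)).trans ?_⟩
  gcongr
  refine (hφ.strictMonoOn hφc).monotoneOn (mem_Ici.2 (by positivity)) (mem_Ici.2 ht) ?_
  nlinarith

/-- Cutting the argument off at `0` changes nothing at norms and gives a function that is convex and
monotone on the whole line, so that continuity and Jensen's inequality apply without domain
conditions. -/
lemma IsNFunction.isDoublingYoung (hφ : IsNFunction φ) (hφc : IsStrictlyConvex φ)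
    (hq : upperSimonenkoIndex φ < ⊤) : IsDoublingYoung fun t => φ (max t 0) where
  convexOn := by
    have hmono := (hφ.strictMonoOn hφc).monotoneOn
    refine ⟨convex_univ, fun x _ y _ a b ha hb hab => ?_⟩
    refine le_trans (hmono (mem_Ici.2 (le_max_right _ _))
      (mem_Ici.2 (by positivity : 0 ≤ a * max x 0 + b * max y 0)) ?_)
      (hφ.convexOn.2 (mem_Ici.2 (le_max_right x 0)) (mem_Ici.2 (le_max_right y 0)) ha hb hab)
    simp only [smul_eq_mul]
    apply max_le
    · gcongr <;> exact le_max_left _ _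
    · positivity
  monotone s t hst := (hφ.strictMonoOn hφc).monotoneOn (mem_Ici.2 (le_max_right _ _))
    (mem_Ici.2 (le_max_right _ _)) (max_le_max_right 0 hst)
  map_zero := by simp [hφ.map_zero]
  doubling := by
    obtain ⟨C, hC⟩ := hφ.doubling hφc hq
    refine ⟨C, fun t ht => ?_⟩
    rw [max_eq_left ht, max_eq_left (by positivity)]
    exact hC t ht

lemma modular_smul_eq_scaledModular {n : ℕ} {F : Type*} [NormedAddCommGroup F] [NormedSpace ℝ F]
    (φ : ℝ → ℝ) (Ω : Set (Vec n)) (v : Vec n → F) {l : ℝ} (hl : 0 ≤ l) :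
    modular φ Ω (fun x => l • v x) =
      scaledModular (fun t => φ (max t 0)) (volume.restrict Ω) l v := by
  unfold modular scaledModular
  refine lintegral_congr fun x => ?_
  rw [norm_smul, Real.norm_of_nonneg hl, ← max_eq_left (by positivity : 0 ≤ l * ‖v x‖)]
  simp

end NFunction

/-! ### Modulars of doubling Young functions -/

section Young

variable {Φ : ℝ → ℝ} (hΦ : IsDoublingYoung Φ)
include hΦ

namespace IsDoublingYoung

lemma nonneg {t : ℝ} (ht : 0 ≤ t) : 0 ≤ Φ t := hΦ.map_zero ▸ hΦ.monotone ht

lemma continuous : Continuous Φ :=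
  continuousOn_univ.1 (hΦ.convexOn.continuousOn isOpen_univ)

lemma map_add_le (s t : ℝ) : Φ (s + t) ≤ (Φ (2 * s) + Φ (2 * t)) / 2 := by
  have h := hΦ.convexOn.2 (mem_univ (2 * s)) (mem_univ (2 * t))
    (show (0 : ℝ) ≤ 1 / 2 by norm_num) (show (0 : ℝ) ≤ 1 / 2 by norm_num) (by norm_num)
  simp only [smul_eq_mul] at h
  rw [show 1 / 2 * (2 * s) + 1 / 2 * (2 * t) = s + t by ring] at h
  linarith

lemma map_mul_le {a t : ℝ} (ha : 0 ≤ a) (ha1 : a ≤ 1) : Φ (a * t) ≤ a * Φ t := by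
  have h := hΦ.convexOn.2 (mem_univ t) (mem_univ 0) ha (show 0 ≤ 1 - a by linarith) (by ring)
  simpa [hΦ.map_zero] using h

lemma map_le_linear {t T : ℝ} (hT : 0 < T) (ht : 0 ≤ t) (htT : t ≤ T) : Φ t ≤ Φ T / T * t := by
  have h := hΦ.map_mul_le (a := t / T) (t := T) (by positivity) ((div_le_one hT).2 htT)
  rw [div_mul_cancel₀ _ hT.ne'] at h
  exact h.trans_eq (by ring)

lemma exists_map_mul_le (c : ℝ) : ∃ C : ℝ≥0, ∀ t, 0 ≤ t → Φ (c * t) ≤ C * Φ t := by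
  obtain ⟨C, hC⟩ := hΦ.doubling
  -- The sign of the doubling constant is not prescribed; `max C 0` can be multiplied through
  -- inequalities.
  have iter : ∀ (k : ℕ) (t : ℝ), 0 ≤ t → Φ (2 ^ k * t) ≤ (max C 0) ^ k * Φ t := by
    intro k
    induction k with
    | zero => intro t _; simp
    | succ k ih =>
      intro t ht
      have h1 := hC (2 ^ k * t) (by positivity)
      have h2 : C * Φ (2 ^ k * t) ≤ max C 0 * (max C 0 ^ k * Φ t) :=
        mul_le_mul (le_max_left _ _) (ih t ht) (hΦ.nonneg (by positivity)) (le_max_right _ _)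
      rw [pow_succ', mul_assoc, pow_succ', mul_assoc]
      exact h1.trans h2
  obtain ⟨k, hk⟩ := pow_unbounded_of_one_lt c (by norm_num : (1 : ℝ) < 2)
  refine ⟨⟨(max C 0) ^ k, by positivity⟩, fun t ht => le_trans (hΦ.monotone ?_) (iter k t ht)⟩
  gcongr

variable {X E : Type*} [MeasurableSpace X] [NormedAddCommGroup E] {μ : Measure X}

lemma aemeasurable_comp {f : X → E} (hf : AEStronglyMeasurable f μ) (l : ℝ) :
    AEMeasurable (fun x => ENNReal.ofReal (Φ (l * ‖f x‖))) μ :=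
  ENNReal.measurable_ofReal.comp_aemeasurable
    (hΦ.continuous.measurable.comp_aemeasurable (hf.norm.aemeasurable.const_mul l))

lemma ofReal_map_add_le {s t : ℝ} (hs : 0 ≤ s) (ht : 0 ≤ t) : ENNReal.ofReal (Φ (s + t)) ≤
    ENNReal.ofReal (Φ (2 * s)) + ENNReal.ofReal (Φ (2 * t)) := by
  have h1 := hΦ.nonneg (mul_nonneg zero_le_two hs)
  have h2 := hΦ.nonneg (mul_nonneg zero_le_two ht)
  rw [← ENNReal.ofReal_add h1 h2]
  exact ENNReal.ofReal_le_ofReal ((hΦ.map_add_le s t).trans (by linarith))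

lemma scaledModular_mono_ae {F : Type*} [NormedAddCommGroup F] {l : ℝ} (hl : 0 ≤ l) {f : X → E}
    {g : X → F} (h : ∀ᵐ x ∂μ, ‖f x‖ ≤ ‖g x‖) :
    scaledModular Φ μ l f ≤ scaledModular Φ μ l g :=
  lintegral_mono_ae <| h.mono fun _ hx =>
    ENNReal.ofReal_le_ofReal (hΦ.monotone (mul_le_mul_of_nonneg_left hx hl))

lemma scaledModular_add_le {l : ℝ} (hl : 0 ≤ l) {f : X → E} (hf : AEStronglyMeasurable f μ)
    (g : X → E) : scaledModular Φ μ l (fun x => f x + g x) ≤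
      scaledModular Φ μ (2 * l) f + scaledModular Φ μ (2 * l) g := by
  unfold scaledModular
  rw [← lintegral_add_left' (hΦ.aemeasurable_comp hf _)]
  refine lintegral_mono fun x => ?_
  refine le_trans (ENNReal.ofReal_le_ofReal (hΦ.monotone
    (mul_le_mul_of_nonneg_left (norm_add_le (f x) (g x)) hl))) ?_
  rw [mul_add, mul_assoc, mul_assoc]
  exact hΦ.ofReal_map_add_le (by positivity) (by positivity)

/-- The main use of doubling: finiteness of the modular does not depend on the scale, so factors
inside `Φ` are harmless. -/
lemma scaledModular_lt_top {l : ℝ} (hl : 0 < l) {f : X → E} (h : scaledModular Φ μ l f < ⊤)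
    (l' : ℝ) : scaledModular Φ μ l' f < ⊤ := by
  obtain ⟨C, hC⟩ := hΦ.exists_map_mul_le (l' / l)
  refine lt_of_le_of_lt (b := C * scaledModular Φ μ l f) ?_ (ENNReal.mul_lt_top (by simp) h)
  unfold scaledModular
  rw [← lintegral_const_mul' _ _ (by simp)]
  refine lintegral_mono fun x => ?_
  have h1 := hC (l * ‖f x‖) (by positivity)
  rw [← mul_assoc, div_mul_cancel₀ _ hl.ne'] at h1
  refine (ENNReal.ofReal_le_ofReal h1).trans_eq ?_
  rw [ENNReal.ofReal_mul (by positivity), ENNReal.ofReal_coe_nnreal]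

omit hΦ in
lemma scaledModular_congr {l : ℝ} {f g : X → E} (h : f =ᵐ[μ] g) :
    scaledModular Φ μ l f = scaledModular Φ μ l g :=
  lintegral_congr_ae (h.mono fun x hx => by simp only [hx])

omit hΦ in
lemma scaledModular_const_smul [NormedSpace ℝ E] (c l : ℝ) (f : X → E) :
    scaledModular Φ μ l (fun x => c • f x) = scaledModular Φ μ (l * |c|) f := by
  unfold scaledModular
  refine lintegral_congr fun x => ?_
  rw [norm_smul, Real.norm_eq_abs, mul_assoc]

end IsDoublingYoung

end Young

/-! ### Continuity of translations in the modular -/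

section Translation

variable {n : ℕ} {E : Type*} [NormedAddCommGroup E]

lemma tendsto_lintegral_sub_translate {f : Vec n → E} (hf : Integrable f) :
    Tendsto (fun y : Vec n => ∫⁻ x, ‖f x - f (x - y)‖ₑ) (𝓝 0) (𝓝 0) := by
  have hf1 : MemLp f 1 volume := memLp_one_iff_integrable.2 hf
  -- The translations form a continuous family of measure-preserving maps, and composition with such
  -- a family is continuous in `L¹`.
  let g : C(Vec n, C(Vec n, Vec n)) :=
    (ContinuousMap.mk (fun p : Vec n × Vec n => p.2 - p.1) (by fun_prop)).curry
  have hg : ∀ y, MeasurePreserving (g y) volume volume := fun y =>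
    measurePreserving_sub_right volume y
  have hc : Continuous fun y => Lp.compMeasurePreserving (g y) (hg y) (hf1.toLp f) :=
    continuous_const.compMeasurePreservingLp g.continuous hg (by simp)
  have h0 := (continuous_const (y := Lp.compMeasurePreserving (g 0) (hg 0) (hf1.toLp f))).edist hc
  have h1 := h0.tendsto 0
  rw [edist_self] at h1
  refine h1.congr fun y => ?_
  rw [Lp.toLp_compMeasurePreserving, Lp.toLp_compMeasurePreserving, Lp.edist_toLp_toLp,
    eLpNorm_one_eq_lintegral_enorm]
  refine lintegral_congr fun x => ?_
  simp [g]

/-- Dominated convergence: every point eventually leaves the sets `M < |f|`. -/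
lemma IsDoublingYoung.exists_scaledModular_tail_le {Φ : ℝ → ℝ} (hΦ : IsDoublingYoung Φ)
    {X : Type*} [MeasurableSpace X] {μ : Measure X} {f : X → E} (hf : AEStronglyMeasurable f μ)
    {l : ℝ} (hfΦ : scaledModular Φ μ l f < ⊤) {ε : ℝ≥0∞} (hε : 0 < ε) :
    ∃ M : ℕ, ∫⁻ x, {x | (M : ℝ) < ‖f x‖}.indicator
      (fun x => ENNReal.ofReal (Φ (l * ‖f x‖))) x ∂μ ≤ ε := by
  have key : Tendsto (fun M : ℕ => ∫⁻ x, {x | (M : ℝ) < ‖f x‖}.indicator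
      (fun x => ENNReal.ofReal (Φ (l * ‖f x‖))) x ∂μ) atTop (𝓝 (∫⁻ _, 0 ∂μ)) := by
    refine tendsto_lintegral_of_dominated_convergence'
      (fun x => ENNReal.ofReal (Φ (l * ‖f x‖))) (fun M => ?_) (fun M => ?_) hfΦ.ne ?_
    · exact (hΦ.aemeasurable_comp hf l).indicator₀
        (nullMeasurableSet_lt aemeasurable_const hf.norm.aemeasurable)
    · exact Eventually.of_forall fun x => indicator_le_self _ _ x
    · refine Eventually.of_forall fun x => ?_
      obtain ⟨M, hM⟩ := exists_nat_ge ‖f x‖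
      refine tendsto_const_nhds.congr' ?_
      filter_upwards [eventually_ge_atTop M] with k hk
      rw [indicator_of_notMem]
      simp only [mem_ofPred_eq, not_lt]
      exact hM.trans (by exact_mod_cast hk)
  rw [lintegral_zero] at key
  exact (key.eventually (eventually_le_nhds hε)).exists

/-- Small differences are controlled linearly by convexity, hence by continuity of translations in
`L¹`. A large difference forces one of the two values to be large, and tails are small uniformly in
the translation because Lebesgue measure is invariant. -/
lemma IsDoublingYoung.tendsto_scaledModular_sub_translate {Φ : ℝ → ℝ} (hΦ : IsDoublingYoung Φ)
    {f : Vec n → E} (hf : Integrable f) {l : ℝ} (hl : 0 < l)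
    (hfΦ : scaledModular Φ volume l f < ⊤) :
    Tendsto (fun y : Vec n => scaledModular Φ volume l (fun x => f x - f (x - y)))
      (𝓝 0) (𝓝 0) := by
  rw [ENNReal.tendsto_nhds_zero]
  intro ε hε
  obtain ⟨M, hM⟩ := hΦ.exists_scaledModular_tail_le hf.1
    (hΦ.scaledModular_lt_top hl hfΦ (2 * l)) (ENNReal.div_pos (a := ε) (b := 3) hε.ne' (by simp))
  set T : Vec n → ℝ≥0∞ := {x | (M : ℝ) < ‖f x‖}.indicator
    (fun x => ENNReal.ofReal (Φ (2 * l * ‖f x‖))) with hT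
  have hTm : AEMeasurable T := (hΦ.aemeasurable_comp hf.1 _).indicator₀
        (nullMeasurableSet_lt aemeasurable_const hf.1.norm.aemeasurable)
  -- `R` is the largest argument of `Φ` in the regime of small differences, and `A` is `l` times the
  -- slope of the chord of `Φ` over `[0, R]`.
  set R : ℝ := l * (2 * M + 1) with hR
  have hR0 : 0 < R := by positivity
  set A : ℝ := Φ R / R * l with hA
  have hA0 : 0 ≤ A := by have := hΦ.nonneg hR0.le; positivity
  have pt : ∀ x y, ENNReal.ofReal (Φ (l * ‖f x - f (x - y)‖)) ≤
      ENNReal.ofReal A * ‖f x - f (x - y)‖ₑ + (T x + T (x - y)) := by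
    intro x y
    by_cases h : ‖f x - f (x - y)‖ ≤ 2 * M + 1
    · refine le_trans ?_ le_self_add
      rw [← ofReal_norm, ← ENNReal.ofReal_mul hA0]
      refine ENNReal.ofReal_le_ofReal ?_
      refine (hΦ.map_le_linear hR0 (by positivity)
        (mul_le_mul_of_nonneg_left h hl.le)).trans_eq ?_
      rw [hA]; ring
    -- The larger of the two norms is at least half the difference, hence exceeds `M`; this is why
    -- the tail is taken at scale `2 * l`.
    · push Not at h
      have h2 := norm_sub_le (f x) (f (x - y))
      refine le_trans ?_ le_add_self
      rcases le_total ‖f x‖ ‖f (x - y)‖ with h3 | h3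
      · refine le_trans ?_ le_add_self
        rw [hT, indicator_of_mem (by simp only [mem_ofPred_eq]; linarith)]
        refine ENNReal.ofReal_le_ofReal (hΦ.monotone ?_)
        nlinarith
      · refine le_trans ?_ le_self_add
        rw [hT, indicator_of_mem (by simp only [mem_ofPred_eq]; linarith)]
        refine ENNReal.ofReal_le_ofReal (hΦ.monotone ?_)
        nlinarith
  have lim : Tendsto (fun y => ENNReal.ofReal A * ∫⁻ x, ‖f x - f (x - y)‖ₑ) (𝓝 0) (𝓝 0) := by
    have := ENNReal.Tendsto.const_mul (a := ENNReal.ofReal A) (tendsto_lintegral_sub_translate hf)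
      (Or.inr (by simp))
    rwa [mul_zero] at this
  filter_upwards [lim.eventually (eventually_le_nhds
    (ENNReal.div_pos (a := ε) (b := 3) hε.ne' (by simp)))] with y hy
  calc scaledModular Φ volume l (fun x => f x - f (x - y))
      ≤ ∫⁻ x, (ENNReal.ofReal A * ‖f x - f (x - y)‖ₑ + (T x + T (x - y))) :=
        lintegral_mono fun x => pt x y
    _ = ENNReal.ofReal A * (∫⁻ x, ‖f x - f (x - y)‖ₑ) + ((∫⁻ x, T x) + ∫⁻ x, T (x - y)) := by
        have hm : AEMeasurable (fun x => ‖f x - f (x - y)‖ₑ) :=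
          (hf.1.sub (hf.comp_sub_right y).1).enorm
        rw [lintegral_add_left' (hm.const_mul _), lintegral_const_mul'' _ hm,
          lintegral_add_left' hTm]
    _ ≤ ε / 3 + (ε / 3 + ε / 3) := by
        rw [lintegral_sub_right_eq_self T y]
        gcongr
    _ = ε := by rw [← add_assoc, ENNReal.add_thirds]

end Translation

/-! ### Mollification in the modular -/

section Mollify

variable {n : ℕ} {E : Type*} [NormedAddCommGroup E] [NormedSpace ℝ E] [CompleteSpace E]

open scoped Convolution

/-- Mollification `ρ ⋆ f` of a vector valued function by a scalar kernel. -/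
noncomputable def mollify (ρ : Vec n → ℝ) (f : Vec n → E) : Vec n → E :=
  MeasureTheory.convolution ρ f (ContinuousLinearMap.lsmul ℝ ℝ) volume

/-- Smooth, compactly supported probability densities. -/
structure IsMollifier (ρ : Vec n → ℝ) : Prop where
  contDiff : ContDiff ℝ ∞ ρ
  hasCompactSupport : HasCompactSupport ρ
  nonneg : ∀ x, 0 ≤ ρ x
  integral_eq_one : ∫ x, ρ x = 1

namespace IsMollifier

variable {ρ : Vec n → ℝ} (hρ : IsMollifier ρ)
include hρ

lemma integrable : Integrable ρ := hρ.contDiff.continuous.integrable_of_hasCompactSupport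
  hρ.hasCompactSupport

omit [CompleteSpace E] in
lemma integrable_smul {f : Vec n → E} (hf : LocallyIntegrable f) (x : Vec n) :
    Integrable fun y => ρ y • f (x - y) :=
  hρ.hasCompactSupport.convolutionExists_left (ContinuousLinearMap.lsmul ℝ ℝ)
    hρ.contDiff.continuous hf x

lemma sub_mollify_eq {f : Vec n → E} (hf : LocallyIntegrable f) (x : Vec n) :
    f x - mollify ρ f x = ∫ y, ρ y • (f x - f (x - y)) := by
  simp_rw [smul_sub]
  rw [integral_sub (hρ.integrable.smul_const _) (hρ.integrable_smul hf x), integral_smul_const,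
    hρ.integral_eq_one, one_smul]
  rfl

/-- Jensen's inequality for the probability measure with density `ρ`. -/
lemma ofReal_map_norm_sub_mollify_le {Φ : ℝ → ℝ} (hΦ : IsDoublingYoung Φ) {l : ℝ} (hl : 0 ≤ l)
    {f : Vec n → E} (hf : LocallyIntegrable f) (x : Vec n) :
    ENNReal.ofReal (Φ (l * ‖f x - mollify ρ f x‖)) ≤
      ∫⁻ y, ENNReal.ofReal (ρ y) * ENNReal.ofReal (Φ (l * ‖f x - f (x - y)‖)) := by
  set r : Vec n → ℝ≥0 := fun y => (ρ y).toNNReal with hr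
  have hrm : Measurable r := hρ.contDiff.continuous.measurable.real_toNNReal
  have hrs : ∀ y (c : ℝ), r y • c = ρ y * c := fun y c => by
    rw [hr, NNReal.smul_def, Real.coe_toNNReal _ (hρ.nonneg y), smul_eq_mul]
  set ν : Measure (Vec n) := volume.withDensity fun y => (r y : ℝ≥0∞) with hν
  have hprob : IsProbabilityMeasure ν := by
    constructor
    rw [hν, withDensity_apply _ MeasurableSet.univ, Measure.restrict_univ]
    change ∫⁻ y, ENNReal.ofReal (ρ y) = 1
    rw [← ofReal_integral_eq_lintegral_ofReal hρ.integrable (Eventually.of_forall hρ.nonneg),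
      hρ.integral_eq_one, ENNReal.ofReal_one]
  set h : Vec n → ℝ := fun y => l * ‖f x - f (x - y)‖ with hh
  have hint : Integrable (fun y => ρ y • (f x - f (x - y))) := by
    simp_rw [smul_sub]
    exact (hρ.integrable.smul_const _).sub (hρ.integrable_smul hf x)
  have hint' : Integrable (fun y => ρ y * h y) := by
    refine (hint.norm.const_mul l).congr (Eventually.of_forall fun y => ?_)
    simp only [norm_smul, Real.norm_of_nonneg (hρ.nonneg y), hh]
    ring
  have hhν : Integrable h ν := by
    rw [hν, integrable_withDensity_iff_integrable_smul hrm]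
    simpa only [hrs] using hint'
  have hbound : l * ‖f x - mollify ρ f x‖ ≤ ∫ y, h y ∂ν := by
    rw [hν, integral_withDensity_eq_integral_smul hrm, hρ.sub_mollify_eq hf x]
    simp only [hrs]
    calc l * ‖∫ y, ρ y • (f x - f (x - y))‖
        ≤ l * ∫ y, ‖ρ y • (f x - f (x - y))‖ := by gcongr; exact norm_integral_le_integral_norm _
      _ = ∫ y, ρ y * h y := by
        rw [← integral_const_mul]
        congr with y
        simp only [norm_smul, Real.norm_of_nonneg (hρ.nonneg y), hh]
        ring
  have hconv : ∫⁻ y, ENNReal.ofReal (ρ y) * ENNReal.ofReal (Φ (h y)) =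
      ∫⁻ y, ENNReal.ofReal (Φ (h y)) ∂ν := by
    rw [hν, lintegral_withDensity_eq_lintegral_mul₀' (by fun_prop)]
    · rfl
    · exact ENNReal.measurable_ofReal.comp_aemeasurable
        (hΦ.continuous.measurable.comp_aemeasurable hhν.1.aemeasurable)
  change _ ≤ ∫⁻ y, ENNReal.ofReal (ρ y) * ENNReal.ofReal (Φ (h y))
  rw [hconv]
  -- Jensen requires `Φ ∘ h` to be integrable; otherwise the right-hand side is infinite.
  by_cases htop : ∫⁻ y, ENNReal.ofReal (Φ (h y)) ∂ν = ⊤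
  · rw [htop]; exact le_top
  have hΦh : ∀ y, 0 ≤ Φ (h y) := fun y => hΦ.nonneg (by positivity)
  have hΦi : Integrable (fun y => Φ (h y)) ν := by
    refine ⟨hΦ.continuous.comp_aestronglyMeasurable hhν.1, ?_⟩
    rw [hasFiniteIntegral_iff_ofReal (Eventually.of_forall hΦh)]
    exact lt_top_iff_ne_top.2 htop
  rw [← ofReal_integral_eq_lintegral_ofReal hΦi (Eventually.of_forall hΦh)]
  refine ENNReal.ofReal_le_ofReal ((hΦ.monotone hbound).trans ?_)
  exact hΦ.convexOn.map_integral_le hΦ.continuous.continuousOn isClosed_univ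
    (Eventually.of_forall fun _ => mem_univ _) hhν hΦi

/-- By Tonelli the error is at most an average of translation errors. The kernel need not be centred
at the origin: an off-centre kernel smooths and shifts at once, which is how supports are later
pushed into `Ω`. -/
lemma scaledModular_sub_mollify_le {Φ : ℝ → ℝ} (hΦ : IsDoublingYoung Φ) {l : ℝ} (hl : 0 ≤ l)
    {f : Vec n → E} (hf : Integrable f) {ε : ℝ≥0∞}
    (hε : ∀ y, ρ y ≠ 0 → scaledModular Φ volume l (fun x => f x - f (x - y)) ≤ ε) :
    scaledModular Φ volume l (fun x => f x - mollify ρ f x) ≤ ε := by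
  have hm : AEMeasurable (fun p : Vec n × Vec n =>
      ENNReal.ofReal (ρ p.2) * ENNReal.ofReal (Φ (l * ‖f p.1 - f (p.1 - p.2)‖)))
      (volume.prod volume) := by
    refine AEMeasurable.mul ?_ (hΦ.aemeasurable_comp (AEStronglyMeasurable.sub ?_ ?_) l)
    · exact (hρ.contDiff.continuous.measurable.comp measurable_snd).ennreal_ofReal.aemeasurable
    · exact hf.1.comp_fst
    · exact hf.1.comp_quasiMeasurePreserving (quasiMeasurePreserving_sub volume volume)
  calc scaledModular Φ volume l (fun x => f x - mollify ρ f x)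
      ≤ ∫⁻ x, ∫⁻ y, ENNReal.ofReal (ρ y) * ENNReal.ofReal (Φ (l * ‖f x - f (x - y)‖)) :=
        lintegral_mono fun x => hρ.ofReal_map_norm_sub_mollify_le hΦ hl hf.locallyIntegrable x
    _ = ∫⁻ y, ∫⁻ x, ENNReal.ofReal (ρ y) * ENNReal.ofReal (Φ (l * ‖f x - f (x - y)‖)) :=
        lintegral_lintegral_swap hm
    _ = ∫⁻ y, ENNReal.ofReal (ρ y) * scaledModular Φ volume l (fun x => f x - f (x - y)) := by
        refine lintegral_congr fun y => ?_
        rw [lintegral_const_mul' _ _ ENNReal.ofReal_ne_top]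
        rfl
    _ ≤ ∫⁻ y, ENNReal.ofReal (ρ y) * ε := by
        refine lintegral_mono fun y => ?_
        by_cases hy : ρ y = 0
        · simp [hy]
        · exact mul_le_mul_right (hε y hy) _
    _ = ε := by
        rw [lintegral_mul_const _ hρ.contDiff.continuous.measurable.ennreal_ofReal,
          ← ofReal_integral_eq_lintegral_ofReal hρ.integrable (Eventually.of_forall hρ.nonneg),
          hρ.integral_eq_one, ENNReal.ofReal_one, one_mul]

end IsMollifier

/-- Mollifiers supported close to `0` are approximate identities for the modular. -/
lemma IsDoublingYoung.exists_scaledModular_sub_mollify_le {Φ : ℝ → ℝ} (hΦ : IsDoublingYoung Φ)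
    {f : Vec n → E} (hf : Integrable f) {l : ℝ} (hl : 0 < l)
    (hfΦ : scaledModular Φ volume l f < ⊤) {ε : ℝ≥0∞} (hε : 0 < ε) :
    ∃ δ > 0, ∀ ρ : Vec n → ℝ, IsMollifier ρ → Function.support ρ ⊆ Metric.ball 0 δ →
      scaledModular Φ volume l (fun x => f x - mollify ρ f x) ≤ ε := by
  obtain ⟨δ, hδ, h⟩ := Metric.eventually_nhds_iff_ball.1
    ((hΦ.tendsto_scaledModular_sub_translate hf hl hfΦ).eventually (eventually_le_nhds hε))
  exact ⟨δ, hδ, fun ρ hρ hs => hρ.scaledModular_sub_mollify_le hΦ hl.le hf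
    fun y hy => h y (hs hy)⟩

end Mollify

/-! ### Calculus of weak gradients -/

section WeakGradient

variable {n N : ℕ} {Ω : Set (Vec n)}

/-- The `i`-th row of a matrix, as a continuous linear map. -/
noncomputable def rowCLM (n N : ℕ) (i : Fin n) : Grad n N →L[ℝ] Vec N :=
  PiLp.proj 2 (fun _ : Fin n => Vec N) i

@[simp] lemma rowCLM_apply (i : Fin n) (A : Grad n N) : rowCLM n N i A = A i := rfl

lemma integrableOn_smul_of_tsupport_subset {E : Type*} [NormedAddCommGroup E] [NormedSpace ℝ E]
    {f : Vec n → E} (hf : LocallyIntegrableOn f Ω) {ψ : Vec n → ℝ} (hψ : Continuous ψ)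
    (hc : HasCompactSupport ψ) (hs : tsupport ψ ⊆ Ω) : IntegrableOn (fun x => ψ x • f x) Ω := by
  have h1 : IntegrableOn (fun x => ψ x • f x) (tsupport ψ) :=
    (hf.integrableOn_compact_subset hs hc).continuousOn_smul hψ.continuousOn hc
  refine Integrable.integrableOn ?_
  rwa [← integrableOn_iff_integrable_of_support_subset (s := tsupport ψ)]
  exact (Function.support_smul_subset_left _ _).trans (subset_tsupport ψ)

lemma contDiff_fderiv_apply {F : Type*} [NormedAddCommGroup F] [NormedSpace ℝ F] {ψ : Vec n → F}
    (hψ : ContDiff ℝ ∞ ψ) (v : Vec n) : ContDiff ℝ ∞ fun x => fderiv ℝ ψ x v :=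
  (hψ.fderiv_right (m := ∞) (by simp)).clm_apply contDiff_const

lemma tsupport_fderiv_apply_subset' {F : Type*} [NormedAddCommGroup F] [NormedSpace ℝ F]
    (ψ : Vec n → F) (v : Vec n) : tsupport (fun x => fderiv ℝ ψ x v) ⊆ tsupport ψ :=
  tsupport_fderiv_apply_subset ℝ v

namespace HasWeakGrad

variable {u u' : Vec n → Vec N} {G G' : Vec n → Grad n N}

lemma integrableOn_smul_row (h : HasWeakGrad Ω u G) {ψ : Vec n → ℝ} (hψ : ContDiff ℝ ∞ ψ)
    (hc : HasCompactSupport ψ) (hs : tsupport ψ ⊆ Ω) (i : Fin n) :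
    IntegrableOn (fun x => ψ x • G x i) Ω := by
  have := integrableOn_smul_of_tsupport_subset h.2.1 hψ.continuous hc hs
  exact ((rowCLM n N i).integrable_comp this).congr (by simp)

lemma integrableOn_fderiv_smul (h : HasWeakGrad Ω u G) {ψ : Vec n → ℝ} (hψ : ContDiff ℝ ∞ ψ)
    (hc : HasCompactSupport ψ) (hs : tsupport ψ ⊆ Ω) (v : Vec n) :
    IntegrableOn (fun x => fderiv ℝ ψ x v • u x) Ω :=
  integrableOn_smul_of_tsupport_subset h.1 (contDiff_fderiv_apply hψ v).continuous
    (hc.fderiv_apply ℝ v) ((tsupport_fderiv_apply_subset' ψ v).trans hs)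

/-- The fundamental lemma of the calculus of variations, applied to each row. -/
lemma unique (hΩ : IsOpen Ω) (h : HasWeakGrad Ω u G) (h' : HasWeakGrad Ω u G') :
    G =ᵐ[volume.restrict Ω] G' := by
  have key : ∀ i, ∀ᵐ x, x ∈ Ω → G x i - G' x i = 0 := by
    intro i
    refine hΩ.ae_eq_zero_of_integral_contDiff_smul_eq_zero (f := fun x => G x i - G' x i) ?_ ?_
    · exact (rowCLM n N i).locallyIntegrableOn_comp (h.2.1.sub h'.2.1)
    · intro ψ hψ hc hs
      have h1 := h.2.2 ψ hψ hc hs i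
      have h2 := h'.2.2 ψ hψ hc hs i
      rw [h1, neg_inj] at h2
      have h3 : ∫ x in Ω, ψ x • (G x i - G' x i) = 0 := by
        simp_rw [smul_sub]
        rw [integral_sub (h.integrableOn_smul_row hψ hc hs i)
          (h'.integrableOn_smul_row hψ hc hs i), h2, sub_self]
      rw [← h3]
      refine (setIntegral_eq_integral_of_forall_compl_eq_zero fun x hx => ?_).symm
      rw [image_eq_zero_of_notMem_tsupport fun hx' => hx (hs hx'), zero_smul]
  rw [Filter.EventuallyEq, ae_restrict_iff' hΩ.measurableSet]
  filter_upwards [ae_all_iff.2 key] with x hx hxΩ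
  ext1 i
  exact sub_eq_zero.1 (hx i hxΩ)

lemma weakGrad_ae_eq (hΩ : IsOpen Ω) (h : HasWeakGrad Ω u G) :
    weakGrad Ω u =ᵐ[volume.restrict Ω] G := by
  have hex : ∃ G, HasWeakGrad Ω u G := ⟨G, h⟩
  unfold weakGrad
  rw [dif_pos hex]
  exact hex.choose_spec.unique hΩ h

lemma weakGrad (h : HasWeakGrad Ω u G) : HasWeakGrad Ω u (weakGrad Ω u) := by
  have hex : ∃ G, HasWeakGrad Ω u G := ⟨G, h⟩
  unfold OrliczSobolev.weakGrad
  rw [dif_pos hex]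
  exact hex.choose_spec

lemma add (h : HasWeakGrad Ω u G) (h' : HasWeakGrad Ω u' G') :
    HasWeakGrad Ω (fun x => u x + u' x) (fun x => G x + G' x) := by
  refine ⟨h.1.add h'.1, h.2.1.add h'.2.1, fun ψ hψ hc hs i => ?_⟩
  simp only [PiLp.add_apply, smul_add]
  rw [integral_add (h.integrableOn_fderiv_smul hψ hc hs _) (h'.integrableOn_fderiv_smul hψ hc hs _),
    integral_add (h.integrableOn_smul_row hψ hc hs i) (h'.integrableOn_smul_row hψ hc hs i),
    h.2.2 ψ hψ hc hs i, h'.2.2 ψ hψ hc hs i, neg_add]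

lemma neg (h : HasWeakGrad Ω u G) : HasWeakGrad Ω (fun x => -u x) (fun x => -G x) := by
  refine ⟨h.1.neg, h.2.1.neg, fun ψ hψ hc hs i => ?_⟩
  simp only [PiLp.neg_apply, smul_neg, integral_neg]
  rw [h.2.2 ψ hψ hc hs i]

lemma sub (h : HasWeakGrad Ω u G) (h' : HasWeakGrad Ω u' G') :
    HasWeakGrad Ω (fun x => u x - u' x) (fun x => G x - G' x) := by
  simpa only [sub_eq_add_neg] using h.add h'.neg

lemma of_univ (h : HasWeakGrad univ u G) : HasWeakGrad Ω u G := by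
  refine ⟨h.1.mono_set (subset_univ _), h.2.1.mono_set (subset_univ _),
    fun ψ hψ hc hs i => ?_⟩
  have h1 := h.2.2 ψ hψ hc (subset_univ _) i
  rw [setIntegral_univ, setIntegral_univ] at h1
  rwa [setIntegral_eq_integral_of_forall_compl_eq_zero,
    setIntegral_eq_integral_of_forall_compl_eq_zero]
  · intro x hx
    rw [image_eq_zero_of_notMem_tsupport fun hx' => hx (hs hx'), zero_smul]
  · intro x hx
    rw [image_eq_zero_of_notMem_tsupport
      (fun hx' => hx (hs (tsupport_fderiv_apply_subset' ψ _ hx'))), zero_smul]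

lemma congr (h : HasWeakGrad Ω u G) (hu : u =ᵐ[volume.restrict Ω] u')
    (hG : G =ᵐ[volume.restrict Ω] G') : HasWeakGrad Ω u' G' := by
  refine ⟨h.1.congr hu, h.2.1.congr hG, fun ψ hψ hc hs i => ?_⟩
  have h1 : (fun x => fderiv ℝ ψ x (EuclideanSpace.single i 1) • u x) =ᵐ[volume.restrict Ω]
      fun x => fderiv ℝ ψ x (EuclideanSpace.single i 1) • u' x := hu.mono fun x hx => by
    simp only [hx]
  have h2 : (fun x => ψ x • G x i) =ᵐ[volume.restrict Ω] fun x => ψ x • G' x i :=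
    hG.mono fun x hx => by simp only [hx]
  rw [← integral_congr_ae h1, h.2.2 ψ hψ hc hs i, integral_congr_ae h2]

end HasWeakGrad

/-- The matrix `ℓ ⊗ a`. -/
noncomputable def outer (ℓ : Vec n →L[ℝ] ℝ) (a : Vec N) : Grad n N :=
  WithLp.toLp 2 fun i => ℓ (EuclideanSpace.single i 1) • a

@[simp] lemma outer_apply (ℓ : Vec n →L[ℝ] ℝ) (a : Vec N) (i : Fin n) :
    outer ℓ a i = ℓ (EuclideanSpace.single i 1) • a := rfl

lemma continuous_outer : Continuous fun p : (Vec n →L[ℝ] ℝ) × Vec N => outer p.1 p.2 := by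
  unfold outer
  refine (PiLp.continuous_toLp 2 _).comp (continuous_pi fun i => ?_)
  fun_prop

/-- Each row has norm at most `‖ℓ‖ * ‖a‖`. The factor `n` is not sharp; only its finiteness matters.
-/
lemma norm_outer_le (ℓ : Vec n →L[ℝ] ℝ) (a : Vec N) : ‖outer ℓ a‖ ≤ n * ‖ℓ‖ * ‖a‖ := by
  rcases Nat.eq_zero_or_pos n with rfl | hn
  · have : outer ℓ a = 0 := by ext i; exact i.elim0
    simp [this]
  refine le_of_sq_le_sq ?_ (by positivity)
  rw [PiLp.norm_sq_eq_of_L2]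
  have h1 : ∀ i, ‖outer ℓ a i‖ ^ 2 ≤ (‖ℓ‖ * ‖a‖) ^ 2 := fun i => by
    rw [outer_apply, norm_smul]
    gcongr
    simpa using ℓ.le_opNorm (EuclideanSpace.single i 1)
  refine (Finset.sum_le_sum fun i _ => h1 i).trans ?_
  have hn' : (1 : ℝ) ≤ n := by exact_mod_cast hn
  simp only [Finset.sum_const, Finset.card_univ, Fintype.card_fin, nsmul_eq_mul]
  rw [mul_assoc, mul_pow (n : ℝ)]
  gcongr
  nlinarith

/-- The gradient of the product `η • u`. -/
noncomputable def productGrad (η : Vec n → ℝ) (u : Vec n → Vec N) (G : Vec n → Grad n N)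
    (x : Vec n) : Grad n N :=
  η x • G x + outer (fderiv ℝ η x) (u x)

lemma aestronglyMeasurable_outer_fderiv {μ : Measure (Vec n)} {η : Vec n → ℝ}
    (hη : ContDiff ℝ ∞ η) {u : Vec n → Vec N} (hu : AEStronglyMeasurable u μ) :
    AEStronglyMeasurable (fun x => outer (fderiv ℝ η x) (u x)) μ :=
  continuous_outer.comp_aestronglyMeasurable
    ((hη.continuous_fderiv (by simp)).aestronglyMeasurable.prodMk hu)

/-- Test the gradient of `u` with `ψ η`; the Leibniz rule for the two smooth factors yields the term
with `∇η`. -/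
lemma HasWeakGrad.product {u : Vec n → Vec N} {G : Vec n → Grad n N} (h : HasWeakGrad univ u G)
    {η : Vec n → ℝ} (hη : ContDiff ℝ ∞ η) :
    HasWeakGrad univ (fun x => η x • u x) (productGrad η u G) := by
  have hu := locallyIntegrableOn_univ.1 h.1
  have hG := locallyIntegrableOn_univ.1 h.2.1
  have ho : LocallyIntegrable (fun x => outer (fderiv ℝ η x) (u x)) := by
    refine (LocallyIntegrable.continuous_smul (g := fun x => n * ‖fderiv ℝ η x‖)
      (by have := hη.continuous_fderiv (by simp); fun_prop) hu).mono
      (aestronglyMeasurable_outer_fderiv hη hu.aestronglyMeasurable) (Eventually.of_forall ?_)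
    intro x
    refine (norm_outer_le _ _).trans_eq ?_
    rw [norm_smul, Real.norm_of_nonneg (by positivity)]
  refine ⟨locallyIntegrableOn_univ.2 (hu.continuous_smul hη.continuous),
    locallyIntegrableOn_univ.2 ((hG.continuous_smul hη.continuous).add ho),
    fun ψ hψ hc hs i => ?_⟩
  have hψη : ContDiff ℝ ∞ fun x => ψ x * η x := hψ.mul hη
  have hψηc : HasCompactSupport fun x => ψ x * η x := hc.mul_right
  have h1 := h.2.2 _ hψη hψηc (subset_univ _) i
  have hd : ∀ x, fderiv ℝ (fun x => ψ x * η x) x (EuclideanSpace.single i 1) • u x =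
      fderiv ℝ ψ x (EuclideanSpace.single i 1) • η x • u x +
        ψ x • fderiv ℝ η x (EuclideanSpace.single i 1) • u x := fun x => by
    rw [fderiv_fun_mul (hψ.differentiable (by simp) x) (hη.differentiable (by simp) x)]
    simp only [_root_.add_apply, _root_.smul_apply, smul_eq_mul]
    rw [add_smul, add_comm, smul_smul, smul_smul, mul_comm (η x)]
  have i1 : Integrable fun x => fderiv ℝ ψ x (EuclideanSpace.single i 1) • η x • u x :=
    (hu.continuous_smul hη.continuous).integrable_smul_left_of_hasCompactSupport
      (contDiff_fderiv_apply hψ _).continuous (hc.fderiv_apply ℝ _)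
  have i2 : Integrable fun x => ψ x • fderiv ℝ η x (EuclideanSpace.single i 1) • u x :=
    (hu.continuous_smul (contDiff_fderiv_apply hη _).continuous
      ).integrable_smul_left_of_hasCompactSupport hψ.continuous hc
  have i3 : Integrable fun x => (ψ x * η x) • G x i := by
    simpa using h.integrableOn_smul_row hψη hψηc (subset_univ _) i
  simp only [setIntegral_univ, hd] at h1 ⊢
  rw [integral_add i1 i2] at h1
  simp only [productGrad, PiLp.add_apply, PiLp.smul_apply, smul_add, outer_apply]
  simp only [smul_smul (ψ _) (η _)]
  rw [integral_add i3 i2, eq_sub_of_add_eq h1]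
  abel

lemma hasWeakGrad_classicalGrad {ψ : Vec n → Vec N} (hψ : ContDiff ℝ ∞ ψ) :
    HasWeakGrad Ω ψ (classicalGrad ψ) := by
  have hcg : Continuous (classicalGrad ψ) := by
    unfold classicalGrad
    exact (PiLp.continuous_toLp 2 _).comp
      (continuous_pi fun i => (contDiff_fderiv_apply hψ _).continuous)
  refine HasWeakGrad.of_univ ⟨hψ.continuous.locallyIntegrable.locallyIntegrableOn _,
    hcg.locallyIntegrable.locallyIntegrableOn _, fun f hf hc _ i => ?_⟩
  simp only [setIntegral_univ]
  rw [eq_neg_iff_add_eq_zero, add_comm, ← eq_neg_iff_add_eq_zero]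
  have hcont := (contDiff_fderiv_apply hψ (EuclideanSpace.single i 1)).continuous
  refine integral_smul_fderiv_eq_neg_fderiv_smul_of_integrable ?_ ?_ ?_
    (fun x _ => hf.differentiable (by simp) x) (fun x _ => hψ.differentiable (by simp) x)
  · exact hψ.continuous.locallyIntegrable.integrable_smul_left_of_hasCompactSupport
      (contDiff_fderiv_apply hf _).continuous (hc.fderiv_apply ℝ _)
  · exact hcont.locallyIntegrable.integrable_smul_left_of_hasCompactSupport hf.continuous hc
  · exact hψ.continuous.locallyIntegrable.integrable_smul_left_of_hasCompactSupport
      hf.continuous hc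

section Mollify

open scoped Pointwise

variable {ρ : Vec n → ℝ} (hρ : IsMollifier ρ)
include hρ

lemma IsMollifier.contDiff_mollify {E : Type*} [NormedAddCommGroup E] [NormedSpace ℝ E]
    [CompleteSpace E] {f : Vec n → E} (hf : LocallyIntegrable f) :
    ContDiff ℝ ∞ (mollify ρ f) :=
  hρ.hasCompactSupport.contDiff_convolution_left _ hρ.contDiff hf

/-- The derivative falls on the kernel, and `t ↦ ρ(x - t)` is a test function. The sign from the
reflection cancels the one in the definition of the weak gradient. -/
lemma IsMollifier.classicalGrad_mollify {u : Vec n → Vec N} {G : Vec n → Grad n N}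
    (h : HasWeakGrad univ u G) : classicalGrad (mollify ρ u) = mollify ρ G := by
  have hu := locallyIntegrableOn_univ.1 h.1
  have hG := locallyIntegrableOn_univ.1 h.2.1
  ext1 x
  ext1 i
  set e : Vec n := EuclideanSpace.single i 1
  set L := ContinuousLinearMap.lsmul ℝ ℝ (E := Vec N)
  have h1 := hρ.hasCompactSupport.hasFDerivAt_convolution_left L (hρ.contDiff.of_le (by simp)) hu x
  have h2 : classicalGrad (mollify ρ u) x i = ∫ t, fderiv ℝ ρ t e • u (x - t) := by
    change fderiv ℝ (mollify ρ u) x e = _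
    rw [show fderiv ℝ (mollify ρ u) x = _ from h1.fderiv, convolution_def,
      ContinuousLinearMap.integral_apply]
    · rfl
    · exact (hρ.hasCompactSupport.fderiv ℝ).convolutionExists_left (L.precompL (Vec n))
        (hρ.contDiff.continuous_fderiv (by simp)) hu x
  have h3 : ∫ t, fderiv ℝ ρ t e • u (x - t) = ∫ t, fderiv ℝ ρ (x - t) e • u t := by
    rw [← integral_sub_left_eq_self _ volume x]
    simp
  set ψ : Vec n → ℝ := fun t => ρ (x - t)
  have hψ : ContDiff ℝ ∞ ψ := hρ.contDiff.comp (contDiff_const.sub contDiff_id)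
  have hψc : HasCompactSupport ψ :=
    hρ.hasCompactSupport.comp_homeomorph (Homeomorph.subLeft x)
  have hψd : ∀ t, fderiv ℝ ψ t e = -fderiv ℝ ρ (x - t) e := fun t => by
    have := ((hρ.contDiff.differentiable (by simp) (x - t)).hasFDerivAt).comp t
      ((hasFDerivAt_id t).const_sub x)
    rw [show fderiv ℝ ψ t = _ from this.fderiv]
    simp
  have h4 := h.2.2 ψ hψ hψc (subset_univ _) i
  simp only [setIntegral_univ] at h4
  change ∫ t, fderiv ℝ ψ t e • u t = _ at h4
  simp only [hψd, neg_smul, integral_neg, neg_inj] at h4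
  have h5 : mollify ρ G x i = ∫ t, ρ t • G (x - t) i := by
    have := (rowCLM n N i).integral_comp_comm (hρ.integrable_smul hG x)
    simp only [map_smul, rowCLM_apply] at this
    exact this.symm
  rw [h2, h3, h4, h5, ← integral_sub_left_eq_self _ volume x]
  simp [ψ]

lemma IsMollifier.tsupport_mollify_subset {E : Type*} [NormedAddCommGroup E] [NormedSpace ℝ E]
    {f : Vec n → E} {S U : Set (Vec n)} (hS : IsCompact S) (hf : ∀ x, x ∉ S → f x = 0)
    (hU : ∀ x ∈ S, ∀ y ∈ tsupport ρ, y + x ∈ U) :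
    HasCompactSupport (mollify ρ f) ∧ tsupport (mollify ρ f) ⊆ U := by
  have hK : IsCompact (tsupport ρ + S) := IsCompact.add hρ.hasCompactSupport hS
  have hsub : Function.support (mollify ρ f) ⊆ tsupport ρ + S := by
    refine (support_convolution_subset _).trans (Set.add_subset_add (subset_tsupport ρ) ?_)
    intro x hx
    by_contra hxS
    exact hx (hf x hxS)
  refine ⟨HasCompactSupport.of_support_subset_isCompact hK hsub, ?_⟩
  refine (closure_minimal hsub hK.isClosed).trans ?_
  rintro _ ⟨y, hy, x, hx, rfl⟩
  exact hU x hx y hy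

end Mollify

/-- The standard mollifier around `c`. -/
lemma isMollifier_normed {c : Vec n} (b : ContDiffBump c) : IsMollifier (b.normed volume) where
  contDiff := b.contDiff_normed
  hasCompactSupport := b.hasCompactSupport_normed
  nonneg := b.nonneg_normed
  integral_eq_one := b.integral_normed

/-- An integrable function of bounded support with vanishing weak gradient vanishes. -/
lemma HasWeakGrad.ae_eq_zero_of_grad_zero [NeZero n] {u : Vec n → Vec N}
    (h : HasWeakGrad univ u 0) (hu : Integrable u) {S : Set (Vec n)} (hS : IsCompact S)
    (hzero : ∀ x, x ∉ S → u x = 0) : u =ᵐ[volume] 0 := by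
  -- For the identity the modular is the `L¹` norm, so the mollification estimate becomes
  -- convergence in `L¹`.
  have hid : IsDoublingYoung fun t : ℝ => t :=
    { convexOn := convexOn_id convex_univ
      monotone := monotone_id
      map_zero := rfl
      doubling := ⟨2, fun t _ => le_rfl⟩ }
  have hmod : ∀ f : Vec n → Vec N, scaledModular (fun t => t) volume 1 f = ∫⁻ x, ‖f x‖ₑ := by
    intro f
    simp [scaledModular]
  -- Every mollification has zero gradient, so it is constant, and its compact support makes the
  -- constant `0`.
  have hmoll : ∀ ρ : Vec n → ℝ, IsMollifier ρ → ∀ x, mollify ρ u x = 0 := by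
    intro ρ hρ
    have hg := hρ.classicalGrad_mollify h
    have hd : Differentiable ℝ (mollify ρ u) :=
      (hρ.contDiff_mollify hu.locallyIntegrable).differentiable (by simp)
    have hfd : ∀ x, fderiv ℝ (mollify ρ u) x = 0 := by
      intro x
      have hx := congrFun hg x
      have h0 : mollify ρ (0 : Vec n → Grad n N) x = 0 := by
        simp [mollify, convolution_zero]
      rw [h0] at hx
      have hb : ∀ i, fderiv ℝ (mollify ρ u) x (EuclideanSpace.single i 1) = 0 := fun i =>
        congrArg (fun A : Grad n N => A i) hx
      refine ContinuousLinearMap.coe_injective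
        ((EuclideanSpace.basisFun (Fin n) ℝ).toBasis.ext fun i => ?_)
      simpa using hb i
    have hcs : HasCompactSupport (mollify ρ u) :=
      (hρ.tsupport_mollify_subset hS hzero (U := univ) (fun _ _ _ _ => mem_univ _)).1
    intro x
    -- Here `n ≥ 1` matters: on the one-point space compact support is no restriction.
    have : Nontrivial (Vec n) := by
      have : Nonempty (Fin n) := ⟨0⟩
      infer_instance
    obtain ⟨y, hy⟩ : ∃ y, y ∉ tsupport (mollify ρ u) := by
      by_contra! hall
      exact noncompact_univ (Vec n) ((eq_univ_of_forall hall) ▸ hcs)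
    rw [is_const_of_fderiv_eq_zero hd hfd x y]
    exact image_eq_zero_of_notMem_tsupport hy
  have hle : ∀ ε : ℝ≥0∞, 0 < ε → ∫⁻ x, ‖u x‖ₑ ≤ ε := by
    intro ε hε
    obtain ⟨δ, hδ, H⟩ := hid.exists_scaledModular_sub_mollify_le hu one_pos
      (by rw [hmod]; exact hu.2) hε
    have hb := isMollifier_normed
      (⟨δ / 2, δ, by positivity, by linarith⟩ : ContDiffBump (0 : Vec n))
    have := H _ hb (ContDiffBump.support_normed_eq _).subset
    rw [hmod] at this
    simpa [hmoll _ hb] using this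
  have hz : ∫⁻ x, ‖u x‖ₑ = 0 :=
    le_antisymm (le_of_forall_gt_imp_ge_of_dense fun ε hε => hle ε hε) zero_le
  rw [lintegral_eq_zero_iff' hu.1.enorm] at hz
  filter_upwards [hz] with x hx
  simpa using hx

end WeakGradient

/-! ### Zero extensions are limits of test functions -/

section Approximation

variable {n N : ℕ} {Ω : Set (Vec n)} {Φ : ℝ → ℝ} {F F' : Vec n → Vec N} {H H' : Vec n → Grad n N}

lemma continuous_classicalGrad {ψ : Vec n → Vec N} (hψ : ContDiff ℝ ∞ ψ) :
    Continuous (classicalGrad ψ) :=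
  (PiLp.continuous_toLp 2 _).comp (continuous_pi fun _ => (contDiff_fderiv_apply hψ _).continuous)

lemma classicalGrad_add {ψ ψ' : Vec n → Vec N} (hψ : ContDiff ℝ ∞ ψ) (hψ' : ContDiff ℝ ∞ ψ')
    (x : Vec n) : classicalGrad (fun x => ψ x + ψ' x) x = classicalGrad ψ x + classicalGrad ψ' x := by
  ext1 i
  change fderiv ℝ (fun x => ψ x + ψ' x) x _ = fderiv ℝ ψ x _ + fderiv ℝ ψ' x _
  rw [fderiv_fun_add (hψ.differentiable (by simp) x) (hψ'.differentiable (by simp) x)]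
  rfl

lemma classicalGrad_zero : classicalGrad (0 : Vec n → Vec N) = 0 := by
  ext1 x
  ext1 i
  change fderiv ℝ (0 : Vec n → Vec N) x _ = 0
  simp

/-- `F` is a function of finite `Φ`-energy on `ℝⁿ` with gradient `H`, vanishing outside `Ω`. -/
structure IsZeroExtension (Φ : ℝ → ℝ) (Ω : Set (Vec n)) (F : Vec n → Vec N)
    (H : Vec n → Grad n N) : Prop where
  hasWeakGrad : HasWeakGrad univ F H
  integrable : Integrable F
  integrable_grad : Integrable H
  modular_lt_top : scaledModular Φ volume 1 F < ⊤
  modular_grad_lt_top : scaledModular Φ volume 1 H < ⊤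
  eq_zero : ∀ x, x ∉ Ω → F x = 0

/-- `F` and its gradient `H` can be approximated, in every modular, by functions in
`C_c^∞(Ω)` and their gradients. -/
def IsApproximable (Φ : ℝ → ℝ) (Ω : Set (Vec n)) (F : Vec n → Vec N) (H : Vec n → Grad n N) :
    Prop :=
  ∀ l : ℝ, 0 < l → ∀ ε : ℝ≥0∞, 0 < ε → ∃ ψ : Vec n → Vec N,
    ContDiff ℝ ∞ ψ ∧ HasCompactSupport ψ ∧ tsupport ψ ⊆ Ω ∧
      scaledModular Φ volume l (fun x => F x - ψ x) ≤ ε ∧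
      scaledModular Φ volume l (fun x => H x - classicalGrad ψ x) ≤ ε

lemma IsApproximable.add (hΦ : IsDoublingYoung Φ) (h : IsApproximable Φ Ω F H)
    (h' : IsApproximable Φ Ω F' H') (hF : AEStronglyMeasurable F)
    (hH : AEStronglyMeasurable H) :
    IsApproximable Φ Ω (fun x => F x + F' x) (fun x => H x + H' x) := by
  intro l hl ε hε
  obtain ⟨ψ, h1, h2, h3, h4, h5⟩ := h (2 * l) (by positivity) (ε / 2) (ENNReal.half_pos hε.ne')
  obtain ⟨ψ', h1', h2', h3', h4', h5'⟩ :=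
    h' (2 * l) (by positivity) (ε / 2) (ENNReal.half_pos hε.ne')
  refine ⟨fun x => ψ x + ψ' x, h1.add h1', h2.add h2',
    (tsupport_add ψ ψ').trans (union_subset h3 h3'), ?_, ?_⟩
  · simp only [add_sub_add_comm]
    refine (hΦ.scaledModular_add_le hl.le (hF.sub h1.continuous.aestronglyMeasurable) _).trans ?_
    exact (add_le_add h4 h4').trans_eq (ENNReal.add_halves ε)
  · simp only [classicalGrad_add h1 h1', add_sub_add_comm]
    refine (hΦ.scaledModular_add_le hl.le
      (hH.sub (continuous_classicalGrad h1).aestronglyMeasurable) _).trans ?_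
    exact (add_le_add h5 h5').trans_eq (ENNReal.add_halves ε)

namespace IsZeroExtension

/-- The bounds on `η` and `∇η` only change the scale of the modular, which doubling absorbs. -/
lemma product (hΦ : IsDoublingYoung Φ) (h : IsZeroExtension Φ Ω F H) {η : Vec n → ℝ}
    (hη : ContDiff ℝ ∞ η) {B : ℝ} (hB : ∀ x, ‖η x‖ ≤ B) {B' : ℝ}
    (hB' : ∀ x, ‖fderiv ℝ η x‖ ≤ B') :
    IsZeroExtension Φ Ω (fun x => η x • F x) (productGrad η F H) := by
  have hB0 : 0 ≤ B := (norm_nonneg _).trans (hB 0)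
  have hB0' : 0 ≤ B' := (norm_nonneg _).trans (hB' 0)
  have hη1 : AEStronglyMeasurable η := hη.continuous.aestronglyMeasurable
  have ho := aestronglyMeasurable_outer_fderiv hη h.integrable.1
  have hob : ∀ x, ‖outer (fderiv ℝ η x) (F x)‖ ≤ ‖(n * B') • F x‖ := fun x => by
    rw [norm_smul, Real.norm_of_nonneg (by positivity)]
    refine (norm_outer_le _ _).trans ?_
    gcongr
    exact hB' x
  have hsm : ∀ {E : Type} [NormedAddCommGroup E] [NormedSpace ℝ E] (f : Vec n → E) (x : Vec n),
      ‖η x • f x‖ ≤ ‖B • f x‖ := fun f x => by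
    rw [norm_smul, norm_smul, Real.norm_of_nonneg hB0]
    gcongr
    exact hB x
  refine ⟨h.hasWeakGrad.product hη, ?_, ?_, ?_, ?_, fun x hx => ?_⟩
  · exact h.integrable.bdd_smul B hη1 (Eventually.of_forall hB)
  · exact (h.integrable_grad.bdd_smul B hη1 (Eventually.of_forall hB)).add
      ((h.integrable.smul (n * B')).mono ho (Eventually.of_forall hob))
  · refine (hΦ.scaledModular_mono_ae zero_le_one (Eventually.of_forall (hsm F))).trans_lt ?_
    rw [IsDoublingYoung.scaledModular_const_smul]
    exact hΦ.scaledModular_lt_top one_pos h.modular_lt_top _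
  · refine (hΦ.scaledModular_add_le zero_le_one (hη1.smul h.integrable_grad.1) _).trans_lt ?_
    refine ENNReal.add_lt_top.2 ⟨?_, ?_⟩
    · refine (hΦ.scaledModular_mono_ae (by norm_num) (Eventually.of_forall (hsm H))).trans_lt ?_
      rw [IsDoublingYoung.scaledModular_const_smul]
      exact hΦ.scaledModular_lt_top one_pos h.modular_grad_lt_top _
    · refine (hΦ.scaledModular_mono_ae (by norm_num) (Eventually.of_forall hob)).trans_lt ?_
      rw [IsDoublingYoung.scaledModular_const_smul]
      exact hΦ.scaledModular_lt_top one_pos h.modular_lt_top _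
  · rw [h.eq_zero x hx, smul_zero]

/-- A function supported in a set that can be pushed into `Ω` is approximable. -/
lemma isApproximable_of_shift (hΦ : IsDoublingYoung Φ) (hΩ : IsOpen Ω)
    (h : IsZeroExtension Φ Ω F H) {S : Set (Vec n)} (hS : IsCompact S)
    (hFS : ∀ x, x ∉ S → F x = 0) {e : Vec n}
    (he : ∀ᶠ t : ℝ in 𝓝[>] 0, ∀ y ∈ S, y + t • e ∈ Ω) : IsApproximable Φ Ω F H := by
  intro l hl ε hε
  obtain ⟨δ₁, hδ₁, H₁⟩ := hΦ.exists_scaledModular_sub_mollify_le h.integrable hl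
    (hΦ.scaledModular_lt_top one_pos h.modular_lt_top l) hε
  obtain ⟨δ₂, hδ₂, H₂⟩ := hΦ.exists_scaledModular_sub_mollify_le h.integrable_grad hl
    (hΦ.scaledModular_lt_top one_pos h.modular_grad_lt_top l) hε
  set δ := min δ₁ δ₂
  have hδ : 0 < δ := lt_min hδ₁ hδ₂
  have hsmall : ∀ᶠ t : ℝ in 𝓝[>] 0, ‖t • e‖ < δ / 2 := by
    have : Tendsto (fun t : ℝ => ‖t • e‖) (𝓝[>] 0) (𝓝 ‖(0 : ℝ) • e‖) :=
      (Continuous.tendsto (by fun_prop) 0).mono_left nhdsWithin_le_nhds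
    rw [zero_smul, norm_zero] at this
    exact this.eventually (eventually_lt_nhds (by positivity))
  -- One translation that moves `S` into `Ω` and is short enough for both mollification estimates.
  -- The kernel is then centred at `t • e`.
  obtain ⟨t, ht1, ht2⟩ := (he.and hsmall).exists
  have hS' : IsCompact ((fun y => y + t • e) '' S) := hS.image (by fun_prop)
  obtain ⟨δ', hδ', hsub⟩ := hS'.exists_cthickening_subset_open hΩ
    (by rintro _ ⟨y, hy, rfl⟩; exact ht1 y hy)
  -- Radius `δ / 2` keeps the shifted kernel inside the ball of radius `δ`; radius `δ'` keeps the
  -- support of the mollification inside `Ω`.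
  set r := min (δ / 2) δ'
  have hr : 0 < r := lt_min (by positivity) hδ'
  set b : ContDiffBump (t • e) := ⟨r / 2, r, by positivity, by linarith⟩
  have hb := isMollifier_normed b
  have hball : Metric.ball (t • e) r ⊆ Metric.ball 0 δ := by
    refine Metric.ball_subset_ball' ?_
    rw [dist_zero_right]
    have : r ≤ δ / 2 := min_le_left _ _
    linarith
  have hsupp : Function.support (b.normed volume) ⊆ Metric.ball 0 δ := by
    rw [b.support_normed_eq]; exact hball
  have hcs := hb.tsupport_mollify_subset (U := Ω) hS hFS (by
    intro x hx y hy
    rw [b.tsupport_normed_eq, Metric.mem_closedBall] at hy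
    refine hsub (Metric.mem_cthickening_of_dist_le _ (x + t • e) _ _ (mem_image_of_mem _ hx) ?_)
    rw [add_comm y x, dist_add_left]
    exact hy.trans (min_le_right _ _))
  refine ⟨mollify (b.normed volume) F, hb.contDiff_mollify h.integrable.locallyIntegrable,
    hcs.1, hcs.2, ?_, ?_⟩
  · exact H₁ _ hb (hsupp.trans (Metric.ball_subset_ball (min_le_left _ _)))
  · rw [hb.classicalGrad_mollify h.hasWeakGrad]
    exact H₂ _ hb (hsupp.trans (Metric.ball_subset_ball (min_le_right _ _)))

end IsZeroExtension

/-- The part of `closure Ω` in the ball around `x` can be pushed into `Ω` by small translations. -/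
def CanShift (Ω : Set (Vec n)) (x : Vec n) (r : ℝ) : Prop :=
  ∃ e : Vec n, ∀ᶠ t : ℝ in 𝓝[>] 0, ∀ y ∈ closure Ω ∩ Metric.closedBall x r, y + t • e ∈ Ω

/-- Near an interior point the zero shift works. Near a boundary point, moving along `e` raises the
height and fixes the horizontal part, so a point on or above the graph moves strictly above it. -/
lemma IsBoundedLipschitzDomain.exists_canShift (hΩ : IsBoundedLipschitzDomain Ω) {x : Vec n}
    (hx : x ∈ closure Ω) : ∃ r > 0, CanShift Ω x r := by
  by_cases hxΩ : x ∈ Ω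
  · obtain ⟨r, hr, hsub⟩ := Metric.nhds_basis_closedBall.mem_iff.1 (hΩ.isOpen.mem_nhds hxΩ)
    exact ⟨r, hr, 0, Eventually.of_forall fun t y hy => by simpa using hsub hy.2⟩
  · have hfr : x ∈ frontier Ω := by
      rw [hΩ.isOpen.frontier_eq]; exact ⟨hx, hxΩ⟩
    obtain ⟨r, hr, e, he, L, γ, hγ, hgraph⟩ := hΩ.lipschitz x hfr
    -- Half the radius, so that shifts by `t < r / 2` stay in the ball where the graph describes
    -- `Ω`.
    refine ⟨r / 2, by positivity, e, ?_⟩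
    have hev : ∀ᶠ t : ℝ in 𝓝[>] 0, t ∈ Ioo 0 (r / 2) := Ioo_mem_nhdsGT (by positivity)
    filter_upwards [hev] with t ht y hy
    have hγc := hγ.continuous
    have hyb : y ∈ Metric.ball x r :=
      Metric.closedBall_subset_ball (by linarith) hy.2
    have hcl : IsClosed {z : Vec n | γ (z - inner ℝ e z • e) ≤ inner ℝ e z} :=
      isClosed_le (by fun_prop) (by fun_prop)
    have hle : γ (y - inner ℝ e y • e) ≤ inner ℝ e y :=
      closure_minimal (fun z hz => ((hgraph z hz.1).1 hz.2).le) hcl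
        (Metric.isOpen_ball.inter_closure ⟨hyb, hy.1⟩)
    have hinner : inner ℝ e (y + t • e) = inner ℝ e y + t := by
      rw [inner_add_right, inner_smul_right, real_inner_self_eq_norm_sq, he]; ring
    rw [hgraph]
    · rw [hinner, add_smul, add_sub_add_right_eq_sub]
      linarith [ht.1]
    · have h1 : dist (y + t • e) x ≤ dist y x + t := by
        refine (dist_triangle _ y _).trans_eq ?_
        rw [dist_eq_norm (y + t • e), add_sub_cancel_left, norm_smul, he,
          Real.norm_of_nonneg ht.1.le, mul_one, add_comm]
      have h2 := Metric.mem_closedBall.1 hy.2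
      rw [Metric.mem_ball]
      linarith [ht.2]

lemma productGrad_add_productGrad_one_sub {η : Vec n → ℝ} (x : Vec n) :
    productGrad η F H x + productGrad (fun x => 1 - η x) F H x = H x := by
  ext1 i
  simp only [productGrad, fderiv_const_sub, PiLp.add_apply, PiLp.smul_apply, outer_apply,
    _root_.neg_apply, sub_smul, one_smul, neg_smul, PiLp.sub_apply]
  abel

/-- Induction on the cover in place of a partition of unity: with `χ = 1` on the half ball around
`c`, the part `χ F` can be shifted, and `(1 - χ) F` vanishes on that half ball, so the other balls
cover it. The function varies in the statement because the induction hypothesis is used for this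
remainder. -/
lemma IsZeroExtension.isApproximable_of_cover (hΦ : IsDoublingYoung Φ) (hΩ : IsOpen Ω)
    (r : Vec n → ℝ) (s : Finset (Vec n)) (hs : ∀ x ∈ s, 0 < r x ∧ CanShift Ω x (r x)) :
    ∀ (F : Vec n → Vec N) (H : Vec n → Grad n N), IsZeroExtension Φ Ω F H →
      (∀ x, (∀ c ∈ s, x ∉ Metric.ball c (r c / 2)) → F x = 0) → IsApproximable Φ Ω F H := by
  induction s using Finset.induction_on with
  | empty =>
    intro F H h h0 l hl ε hε
    have hF : F = 0 := funext fun x => h0 x (by simp)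
    -- With no balls left `F` is zero, and uniqueness of weak gradients gives `H = 0`.
    have hH : H =ᵐ[volume] 0 := by
      have h1 := h.hasWeakGrad
      rw [hF] at h1
      have h2 := hasWeakGrad_classicalGrad (Ω := univ) (ψ := (0 : Vec n → Vec N)) contDiff_const
      rw [classicalGrad_zero] at h2
      simpa using h1.unique isOpen_univ h2
    refine ⟨0, contDiff_const, HasCompactSupport.zero, by simp [tsupport], ?_, ?_⟩
    · simp [hF, scaledModular, hΦ.map_zero]
    · rw [IsDoublingYoung.scaledModular_congr (g := 0)]
      · simp [scaledModular, hΦ.map_zero]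
      · filter_upwards [hH] with x hx
        simp [hx, classicalGrad_zero]
  | insert c s hc ih =>
    intro F H h h0
    obtain ⟨hr, e, he⟩ := hs c (Finset.mem_insert_self c s)
    let χ : ContDiffBump c := ⟨r c / 2, r c, by positivity, by linarith⟩
    have hχ : ContDiff ℝ ∞ χ := χ.contDiff
    have hχ' : ContDiff ℝ ∞ fun x => 1 - χ x := contDiff_const.sub hχ
    obtain ⟨B', hB'⟩ := (χ.hasCompactSupport.fderiv ℝ).exists_bound_of_continuous
      (hχ.continuous_fderiv (by simp))
    have h1 : IsZeroExtension Φ Ω (fun x => χ x • F x) (productGrad χ F H) :=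
      h.product hΦ hχ (B := 1) (fun x => by
        rw [Real.norm_of_nonneg χ.nonneg]; exact χ.le_one) hB'
    have h2 : IsZeroExtension Φ Ω (fun x => (1 - χ x) • F x)
        (productGrad (fun x => 1 - χ x) F H) :=
      h.product hΦ hχ' (B := 1) (fun x => by
        rw [Real.norm_of_nonneg (sub_nonneg.2 χ.le_one)]
        linarith [χ.nonneg (x := x)]) (B' := B') (fun x => by
        rw [fderiv_const_sub, norm_neg]; exact hB' x)
    have a1 : IsApproximable Φ Ω (fun x => χ x • F x) (productGrad χ F H) := by
      refine h1.isApproximable_of_shift hΦ hΩ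
        (S := closure Ω ∩ Metric.closedBall c (r c)) ?_ ?_ he
      · exact (isCompact_closedBall c (r c)).inter_left isClosed_closure
      · intro x hx
        by_cases hxΩ : x ∈ Ω
        · have : x ∉ Metric.closedBall c (r c) := fun hxc => hx ⟨subset_closure hxΩ, hxc⟩
          rw [χ.zero_of_le_dist (by rw [Metric.mem_closedBall, not_le] at this; exact this.le),
            zero_smul]
        · rw [h.eq_zero x hxΩ, smul_zero]
    have a2 : IsApproximable Φ Ω (fun x => (1 - χ x) • F x)
        (productGrad (fun x => 1 - χ x) F H) := by
      refine ih (fun x hx => hs x (Finset.mem_insert_of_mem hx)) _ _ h2 fun x hx => ?_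
      by_cases hxc : x ∈ Metric.ball c (r c / 2)
      · rw [χ.one_of_mem_closedBall (Metric.ball_subset_closedBall hxc), sub_self, zero_smul]
      · rw [h0 x, smul_zero]
        intro c' hc'
        rcases Finset.mem_insert.1 hc' with rfl | hc'
        · exact hxc
        · exact hx c' hc'
    have a3 := a1.add hΦ a2 h1.integrable.1 h1.integrable_grad.1
    have e1 : (fun x => χ x • F x + (1 - χ x) • F x) = F := by
      ext1 x; rw [← add_smul, add_sub_cancel, one_smul]
    have e2 : (fun x => productGrad χ F H x + productGrad (fun x => 1 - χ x) F H x) = H :=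
      funext fun x => productGrad_add_productGrad_one_sub x
    rwa [e1, e2] at a3

lemma IsZeroExtension.isApproximable (hΦ : IsDoublingYoung Φ) (hΩ : IsBoundedLipschitzDomain Ω)
    (h : IsZeroExtension Φ Ω F H) : IsApproximable Φ Ω F H := by
  have hex : ∀ x : Vec n, ∃ r : ℝ, x ∈ closure Ω → 0 < r ∧ CanShift Ω x r := fun x => by
    by_cases hx : x ∈ closure Ω
    · obtain ⟨r, hr⟩ := hΩ.exists_canShift hx
      exact ⟨r, fun _ => hr⟩
    · exact ⟨0, fun h => absurd h hx⟩
  choose r hr using hex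
  obtain ⟨s, hs, hcov⟩ := hΩ.isBounded.isCompact_closure.elim_nhds_subcover
    (fun x => Metric.ball x (r x / 2))
    (fun x hx => Metric.ball_mem_nhds x (half_pos (hr x hx).1))
  refine IsZeroExtension.isApproximable_of_cover hΦ hΩ.isOpen r s (fun x hx => hr x (hs x hx))
    F H h fun x hx => h.eq_zero x fun hxΩ => ?_
  obtain ⟨c, hc, hxc⟩ := mem_iUnion₂.1 (hcov (subset_closure hxΩ))
  exact hx c hc hxc

end Approximation

/-! ### Coordinate lines and projections of the boundary -/

section Lines

variable {m : ℕ}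

/-- Splitting off the `i`-th coordinate. -/
noncomputable def splitCoord (i : Fin (m + 1)) : Vec (m + 1) ≃ᵐ ℝ × (Fin m → ℝ) :=
  (MeasurableEquiv.toLp 2 (Fin (m + 1) → ℝ)).symm.trans
    (MeasurableEquiv.piFinSuccAbove (fun _ => ℝ) i)

lemma measurePreserving_splitCoord (i : Fin (m + 1)) :
    MeasurePreserving (splitCoord i) volume volume :=
  (volume_preserving_piFinSuccAbove (fun _ => ℝ) i).comp
    (EuclideanSpace.volume_preserving_symm_measurableEquiv_toLp (Fin (m + 1)))

/-- The projection forgetting the `i`-th coordinate. -/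
def dropCoord (i : Fin (m + 1)) (x : Vec (m + 1)) : Fin m → ℝ := fun j => x (i.succAbove j)

lemma splitCoord_apply (i : Fin (m + 1)) (x : Vec (m + 1)) :
    splitCoord i x = (x i, dropCoord i x) := rfl

lemma lipschitzWith_dropCoord (i : Fin (m + 1)) : LipschitzWith 1 (dropCoord i) := by
  refine LipschitzWith.of_dist_le_mul fun x y => ?_
  rw [NNReal.coe_one, one_mul, dist_pi_le_iff dist_nonneg]
  intro j
  rw [dist_eq_norm x y]
  exact PiLp.norm_apply_le (x - y) (i.succAbove j)

/-- The projection is `1`-Lipschitz into the sup norm, for which the `m`-dimensional Hausdorff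
measure on `ℝᵐ` is Lebesgue measure. -/
lemma volume_image_dropCoord_le (i : Fin (m + 1)) (A : Set (Vec (m + 1))) :
    volume (dropCoord i '' A) ≤ Measure.hausdorffMeasure (m : ℝ) A := by
  have h := (lipschitzWith_dropCoord i).hausdorffMeasure_image_le (d := (m : ℝ)) (by positivity) A
  have h2 : (Measure.hausdorffMeasure (m : ℝ) : Measure (Fin m → ℝ)) = volume := by
    have := hausdorffMeasure_pi_real (ι := Fin m)
    rwa [Fintype.card_fin] at this
  rw [h2] at h
  simpa using h

/-- The line in direction `i` over `z`. -/
noncomputable def coordLine (i : Fin (m + 1)) (z : Fin m → ℝ) (t : ℝ) : Vec (m + 1) :=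
  (splitCoord i).symm (t, z)

lemma coordLine_apply (i : Fin (m + 1)) (z : Fin m → ℝ) (t : ℝ) (j : Fin (m + 1)) :
    coordLine i z t j = i.insertNth (α := fun _ => ℝ) t z j := rfl

lemma dropCoord_coordLine (i : Fin (m + 1)) (z : Fin m → ℝ) (t : ℝ) :
    dropCoord i (coordLine i z t) = z :=
  congrArg Prod.snd ((splitCoord i).apply_symm_apply (t, z))

lemma coordLine_dropCoord (i : Fin (m + 1)) (x : Vec (m + 1)) :
    coordLine i (dropCoord i x) (x i) = x :=
  (splitCoord i).symm_apply_apply x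

lemma coordLine_same (i : Fin (m + 1)) (z : Fin m → ℝ) (t : ℝ) : coordLine i z t i = t := by
  rw [coordLine_apply, Fin.insertNth_apply_same]

lemma coordLine_eq (i : Fin (m + 1)) (z : Fin m → ℝ) (t : ℝ) :
    coordLine i z t = coordLine i z 0 + t • EuclideanSpace.single i 1 := by
  ext j
  rw [PiLp.add_apply, PiLp.smul_apply, coordLine_apply, coordLine_apply]
  rcases Fin.eq_self_or_eq_succAbove i j with rfl | ⟨k, rfl⟩
  · simp
  · simp [(Fin.succAbove_ne i k)]

lemma hasDerivAt_coordLine (i : Fin (m + 1)) (z : Fin m → ℝ) (t : ℝ) :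
    HasDerivAt (coordLine i z) (EuclideanSpace.single i 1) t := by
  have h : coordLine i z = fun t => coordLine i z 0 + t • EuclideanSpace.single i 1 :=
    funext (coordLine_eq i z)
  rw [h]
  simpa using ((hasDerivAt_id t).smul_const (EuclideanSpace.single i (1 : ℝ))).const_add
    (coordLine i z 0)

lemma continuous_coordLine (i : Fin (m + 1)) (z : Fin m → ℝ) : Continuous (coordLine i z) :=
  continuous_iff_continuousAt.2 fun t => (hasDerivAt_coordLine i z t).continuousAt

variable {Ω : Set (Vec (m + 1))}

lemma isBounded_preimage_coordLine (hb : Bornology.IsBounded Ω) (i : Fin (m + 1))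
    (z : Fin m → ℝ) : Bornology.IsBounded (coordLine i z ⁻¹' Ω) := by
  obtain ⟨R, hR⟩ := hb.exists_norm_le
  refine (Metric.isBounded_closedBall (x := (0 : ℝ)) (r := R)).subset fun t ht => ?_
  rw [mem_closedBall_zero_iff, ← coordLine_same i z t]
  exact (PiLp.norm_apply_le (coordLine i z t) i).trans (hR _ ht)

/-- Along this line `f` cut off to `Ω` is differentiable everywhere: at points of `∂Ω` because `f`
vanishes nearby, off `closure Ω` trivially. The cut-off function and its derivative are integrable,
so the derivative integrates to zero. -/
lemma integral_coordLine_eq_zero (hΩ : IsOpen Ω) (hb : Bornology.IsBounded Ω)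
    {f : Vec (m + 1) → ℝ} (hf : ContDiff ℝ 1 f) (i : Fin (m + 1)) (z : Fin m → ℝ)
    (hz : ∀ x ∈ frontier Ω, dropCoord i x = z → ∀ᶠ y in 𝓝 x, f y = 0) :
    ∫ t, Ω.indicator (fun x => fderiv ℝ f x (EuclideanSpace.single i 1)) (coordLine i z t) = 0 := by
  set T := coordLine i z ⁻¹' Ω with hT
  have hcl := continuous_coordLine i z
  have hTo : IsOpen T := hΩ.preimage hcl
  have hTb : Bornology.IsBounded T := isBounded_preimage_coordLine hb i z
  have hint : ∀ k : Vec (m + 1) → ℝ, Continuous k →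
      Integrable fun t => Ω.indicator k (coordLine i z t) := by
    intro k hk
    have h1 : IntegrableOn (fun t => k (coordLine i z t)) T :=
      ((hk.comp hcl).continuousOn.integrableOn_compact hTb.isCompact_closure).mono_set
        subset_closure
    exact (integrable_indicator_iff hTo.measurableSet).2 h1
  have hfd : Continuous fun x => fderiv ℝ f x (EuclideanSpace.single i 1) :=
    (hf.continuous_fderiv (by simp)).clm_apply continuous_const
  refine integral_eq_zero_of_hasDerivAt_of_integrable
    (f := fun t => Ω.indicator f (coordLine i z t)) (fun t => ?_) (hint _ hfd)
    (hint _ hf.continuous)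
  by_cases hc : coordLine i z t ∈ Ω
  · rw [indicator_of_mem hc]
    have hd : HasDerivAt (fun t => f (coordLine i z t))
        (fderiv ℝ f (coordLine i z t) (EuclideanSpace.single i 1)) t :=
      ((hf.differentiable (by simp) _).hasFDerivAt).comp_hasDerivAt t (hasDerivAt_coordLine i z t)
    refine hd.congr_of_eventuallyEq ?_
    filter_upwards [hTo.mem_nhds hc] with s hs
    exact indicator_of_mem (show coordLine i z s ∈ Ω from hs) f
  · rw [indicator_of_notMem hc]
    refine (hasDerivAt_const t (0 : ℝ)).congr_of_eventuallyEq ?_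
    by_cases hcc : coordLine i z t ∈ closure Ω
    · have hfr : coordLine i z t ∈ frontier Ω := by
        rw [hΩ.frontier_eq]; exact ⟨hcc, hc⟩
      filter_upwards [hcl.continuousAt.eventually (hz _ hfr (dropCoord_coordLine i z t))]
        with s hs
      by_cases hsΩ : coordLine i z s ∈ Ω
      · rw [indicator_of_mem hsΩ]; exact hs
      · exact indicator_of_notMem hsΩ _
    · filter_upwards [hcl.continuousAt.eventually (isClosed_closure.isOpen_compl.mem_nhds hcc)]
        with s hs
      exact indicator_of_notMem (fun h => hs (subset_closure h)) _

/-- If the smooth function `f` vanishes near the boundary points of `Ω` that do not project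
into `E`, then the integral of a partial derivative over `Ω` only sees the lines over `E`. -/
lemma setIntegral_fderiv_eq_setIntegral_cylinder (hΩ : IsOpen Ω) (hb : Bornology.IsBounded Ω)
    {f : Vec (m + 1) → ℝ} (hf : ContDiff ℝ 1 f) (i : Fin (m + 1)) {E : Set (Fin m → ℝ)}
    (hE : MeasurableSet E)
    (hz : ∀ x ∈ frontier Ω, dropCoord i x ∉ E → ∀ᶠ y in 𝓝 x, f y = 0) :
    ∫ x in Ω, fderiv ℝ f x (EuclideanSpace.single i 1) =
      ∫ x in Ω ∩ dropCoord i ⁻¹' E, fderiv ℝ f x (EuclideanSpace.single i 1) := by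
  set D := fun x => fderiv ℝ f x (EuclideanSpace.single i 1) with hD
  have hDc : Continuous D := (hf.continuous_fderiv (by simp)).clm_apply continuous_const
  have hDi : IntegrableOn D Ω :=
    (hDc.continuousOn.integrableOn_compact hb.isCompact_closure).mono_set subset_closure
  have hEm : MeasurableSet (dropCoord i ⁻¹' E) :=
    (lipschitzWith_dropCoord i).continuous.measurable hE
  rw [← integral_inter_add_sdiff hEm hDi, add_eq_left,
    ← integral_indicator (hΩ.measurableSet.diff hEm)]
  have hint : Integrable ((Ω \ dropCoord i ⁻¹' E).indicator D) :=
    (integrable_indicator_iff (hΩ.measurableSet.diff hEm)).2 (hDi.mono_set sdiff_subset)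
  have hmp := (measurePreserving_splitCoord i).symm
  -- Fubini with the `i`-th coordinate innermost: a line over `E` contributes nothing to the
  -- difference set, and on any other line the integral of the derivative vanishes.
  rw [← hmp.integral_comp (splitCoord i).symm.measurableEmbedding, Measure.volume_eq_prod,
    integral_prod_symm]
  · refine integral_eq_zero_of_ae (Eventually.of_forall fun z => ?_)
    change ∫ t, (Ω \ dropCoord i ⁻¹' E).indicator D (coordLine i z t) = 0
    by_cases hzE : z ∈ E
    · refine integral_eq_zero_of_ae (Eventually.of_forall fun t => indicator_of_notMem ?_ _)
      rintro ⟨-, h⟩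
      rw [mem_preimage, dropCoord_coordLine] at h
      exact h hzE
    · rw [← integral_coordLine_eq_zero hΩ hb hf i z
        (fun x hx hxz => hz x hx (by rwa [hxz]))]
      congr with t
      have : coordLine i z t ∉ dropCoord i ⁻¹' E := by
        rwa [mem_preimage, dropCoord_coordLine]
      by_cases ht : coordLine i z t ∈ Ω
      · rw [indicator_of_mem ht, indicator_of_mem (show _ ∈ Ω \ _ from ⟨ht, this⟩)]
      · rw [indicator_of_notMem ht, indicator_of_notMem (fun h => ht h.1)]
  · exact (hmp.integrable_comp_emb (splitCoord i).symm.measurableEmbedding).2 hint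

lemma volume_inter_cylinder_le {R : ℝ} (hR : ∀ x ∈ Ω, ‖x‖ ≤ R) (i : Fin (m + 1))
    (E : Set (Fin m → ℝ)) :
    volume (Ω ∩ dropCoord i ⁻¹' E) ≤ ENNReal.ofReal (2 * R) * volume E := by
  have hsub : Ω ∩ dropCoord i ⁻¹' E ⊆ splitCoord i ⁻¹' (Icc (-R) R ×ˢ E) := by
    rintro x ⟨hx, hxE⟩
    rw [mem_preimage, splitCoord_apply]
    refine ⟨?_, hxE⟩
    refine abs_le.1 ?_
    exact (PiLp.norm_apply_le x i).trans (hR x hx)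
  refine (measure_mono hsub).trans ?_
  rw [(measurePreserving_splitCoord i).measure_preimage_equiv, Measure.volume_eq_prod,
    Measure.prod_prod, Real.volume_Icc]
  ring_nf
  exact le_rfl

/-- A coordinate line through `Ω` must leave the bounded set, so the projection of `∂Ω` covers that
of `Ω`. Were it null, the nonempty open set `Ω` would be null. -/
lemma boundaryMeasure_ne_zero (hΩ : IsOpen Ω) (hne : Ω.Nonempty) (hb : Bornology.IsBounded Ω) :
    boundaryMeasure Ω ≠ 0 := by
  intro h0
  have hH : Measure.hausdorffMeasure (m : ℝ) (frontier Ω) = 0 := by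
    have := congrArg (fun μ : Measure (Vec (m + 1)) => μ univ) h0
    simpa [boundaryMeasure] using this
  have hE := volume_image_dropCoord_le 0 (frontier Ω)
  rw [hH, nonpos_iff_eq_zero] at hE
  obtain ⟨R, hR⟩ := hb.exists_norm_le
  have hsub : Ω ⊆ Ω ∩ dropCoord 0 ⁻¹' (dropCoord 0 '' frontier Ω) := by
    intro x hx
    refine ⟨hx, ?_⟩
    set z := dropCoord 0 x with hz
    have hcl := continuous_coordLine 0 z
    set T := coordLine 0 z ⁻¹' Ω with hT
    have hTo : IsOpen T := hΩ.preimage hcl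
    have hTne : T.Nonempty := ⟨x 0, by rw [hT, mem_preimage, hz, coordLine_dropCoord]; exact hx⟩
    have hTu : T ≠ univ := fun h =>
      NormedSpace.unbounded_univ ℝ ℝ (h ▸ isBounded_preimage_coordLine hb 0 z)
    obtain ⟨t, ht⟩ := nonempty_frontier_iff.2 ⟨hTne, hTu⟩
    rw [hTo.frontier_eq] at ht
    refine ⟨coordLine 0 z t, ?_, dropCoord_coordLine 0 z t⟩
    rw [hΩ.frontier_eq]
    exact ⟨hcl.closure_preimage_subset _ ht.1, ht.2⟩
  have hvol := (measure_mono hsub).trans (volume_inter_cylinder_le hR 0 _)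
  rw [hE, mul_zero, nonpos_iff_eq_zero] at hvol
  exact (hΩ.measure_pos volume hne).ne' hvol

end Lines

/-! ### Smooth truncations and convergence of their derivatives -/

/-- Smooth bounded nondecreasing functions vanishing exactly on `(-∞, 0]`, with slope at most `1`. -/
structure IsCutoff (θ : ℝ → ℝ) : Prop where
  contDiff : ContDiff ℝ ∞ θ
  eq_zero : ∀ s, s ≤ 0 → θ s = 0
  pos : ∀ s, 0 < s → 0 < θ s
  abs_le_one : ∀ s, |θ s| ≤ 1
  deriv_nonneg : ∀ s, 0 ≤ deriv θ s
  deriv_le_one : ∀ s, deriv θ s ≤ 1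

lemma exists_isCutoff : ∃ θ, IsCutoff θ := by
  have hs : ContDiff ℝ ∞ Real.smoothTransition := Real.smoothTransition.contDiff
  have hc : Continuous (deriv Real.smoothTransition) := hs.continuous_deriv (by simp)
  obtain ⟨M, hM⟩ := isCompact_Icc.exists_bound_of_continuousOn (s := Icc (0 : ℝ) 1) hc.continuousOn
  have hM0 : 0 ≤ M := (norm_nonneg _).trans (hM 0 ⟨le_rfl, zero_le_one⟩)
  have hM' : ∀ s, deriv Real.smoothTransition s ≤ M := by
    intro s
    by_cases h0 : s < 0
    · have : Real.smoothTransition =ᶠ[𝓝 s] fun _ => 0 := by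
        filter_upwards [eventually_lt_nhds h0] with t ht
        exact Real.smoothTransition.zero_of_nonpos ht.le
      rw [this.deriv_eq, deriv_const]; exact hM0
    by_cases h1 : 1 < s
    · have : Real.smoothTransition =ᶠ[𝓝 s] fun _ => 1 := by
        filter_upwards [eventually_gt_nhds h1] with t ht
        exact Real.smoothTransition.one_of_one_le ht.le
      rw [this.deriv_eq, deriv_const]; exact hM0
    exact (le_abs_self _).trans (hM s ⟨not_lt.1 h0, not_lt.1 h1⟩)
  have hd : ∀ s, deriv (fun s => (M + 1)⁻¹ * Real.smoothTransition s) s =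
      (M + 1)⁻¹ * deriv Real.smoothTransition s := fun s =>
    deriv_const_mul _ (hs.differentiable (by simp) s)
  -- `M` bounds the slope of the transition. The divisor `M + 1` is at least `1`, so scaling also
  -- preserves the bound `1` on the values.
  refine ⟨fun s => (M + 1)⁻¹ * Real.smoothTransition s, contDiff_const.mul hs, fun s h => ?_,
    fun s h => ?_, fun s => ?_, fun s => ?_, fun s => ?_⟩
  · simp [Real.smoothTransition.zero_of_nonpos h]
  · have := Real.smoothTransition.pos_of_pos h
    positivity
  · have h1 := Real.smoothTransition.nonneg s
    have h2 := Real.smoothTransition.le_one s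
    rw [abs_of_nonneg (by positivity)]
    exact mul_le_one₀ (inv_le_one_of_one_le₀ (by linarith)) h1 h2
  · rw [hd]
    exact mul_nonneg (by positivity) Real.smoothTransition.monotone.deriv_nonneg
  · rw [hd, inv_mul_le_iff₀ (by positivity)]
    linarith [hM' s]

/-- `L¹` convergence of the derivatives of `θ(w_k)`, multiplied by bounded functions. -/
lemma tendsto_lintegral_chain_rule {X : Type*} [MeasurableSpace X] {μ : Measure X}
    [IsFiniteMeasure μ] {θ θ' : ℝ → ℝ} (hθ : Continuous θ) (hθ' : Continuous θ')
    (hθ1 : ∀ s, |θ s| ≤ 1) (hθ1' : ∀ s, |θ' s| ≤ 1) {α β w p : X → ℝ} {wk pk : ℕ → X → ℝ}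
    (hα : AEStronglyMeasurable α μ) (hβ : AEStronglyMeasurable β μ)
    {C : ℝ} (hαC : ∀ x, |α x| ≤ C) (hβC : ∀ x, |β x| ≤ C)
    (hw : AEStronglyMeasurable w μ) (hwk : ∀ k, AEStronglyMeasurable (wk k) μ)
    (hp : Integrable p μ)
    (hlim : ∀ᵐ x ∂μ, Tendsto (fun k => wk k x) atTop (𝓝 (w x)))
    (hpk : Tendsto (fun k => ∫⁻ x, ‖pk k x - p x‖ₑ ∂μ) atTop (𝓝 0)) :
    Tendsto (fun k => ∫⁻ x, ‖(α x * θ (wk k x) + β x * (θ' (wk k x) * pk k x)) -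
      (α x * θ (w x) + β x * (θ' (w x) * p x))‖ₑ ∂μ) atTop (𝓝 0) := by
  -- The part of the error with `p` kept fixed, treated by dominated convergence. The rest is `β
  -- θ'(w_k) (p_k - p)`, at most `C |p_k - p|`.
  set h : ℕ → X → ℝ := fun k x =>
    α x * (θ (wk k x) - θ (w x)) + β x * ((θ' (wk k x) - θ' (w x)) * p x) with hh
  have hhm : ∀ k, AEStronglyMeasurable (h k) μ := fun k =>
    (hα.mul ((hθ.comp_aestronglyMeasurable (hwk k)).sub (hθ.comp_aestronglyMeasurable hw))).add
      (hβ.mul (((hθ'.comp_aestronglyMeasurable (hwk k)).sub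
        (hθ'.comp_aestronglyMeasurable hw)).mul hp.1))
  have habs : ∀ {f : ℝ → ℝ}, (∀ s, |f s| ≤ 1) → ∀ s t, |f s - f t| ≤ 2 := fun hf s t =>
    (abs_sub _ _).trans (by linarith [hf s, hf t])
  have hbound : ∀ k x, ‖h k x‖ ≤ 2 * C + 2 * C * ‖p x‖ := by
    intro k x
    have hC0 : 0 ≤ C := (abs_nonneg _).trans (hαC x)
    refine (norm_add_le _ _).trans (add_le_add ?_ ?_)
    · rw [norm_mul, mul_comm 2]
      exact mul_le_mul (hαC x) (habs hθ1 _ _) (norm_nonneg _) hC0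
    · rw [norm_mul, norm_mul, ← mul_assoc, mul_comm 2]
      refine mul_le_mul_of_nonneg_right ?_ (norm_nonneg _)
      exact mul_le_mul (hβC x) (habs hθ1' _ _) (norm_nonneg _) hC0
  have hlim1 : Tendsto (fun k => ∫⁻ x, ‖h k x‖ₑ ∂μ) atTop (𝓝 0) := by
    have := tendsto_lintegral_norm_of_dominated_convergence (F := h) (f := fun _ => (0 : ℝ))
      (bound := fun x => 2 * C + 2 * C * ‖p x‖) hhm
      ((integrable_const _).add (hp.norm.const_mul _)).2
      (fun k => Eventually.of_forall (hbound k)) (by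
        filter_upwards [hlim] with x hx
        have h1 := ((hθ.tendsto _).comp hx).sub_const (θ (w x))
        have h2 := ((hθ'.tendsto _).comp hx).sub_const (θ' (w x))
        have h3 := (h1.const_mul (α x)).add ((h2.mul_const (p x)).const_mul (β x))
        simpa [hh] using h3)
    simpa only [sub_zero, ofReal_norm] using this
  have hlim2 : Tendsto (fun k => ENNReal.ofReal C * ∫⁻ x, ‖pk k x - p x‖ₑ ∂μ) atTop (𝓝 0) := by
    have := ENNReal.Tendsto.const_mul (a := ENNReal.ofReal C) hpk (Or.inr (by simp))
    rwa [mul_zero] at this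
  have hsum := hlim1.add hlim2
  rw [add_zero] at hsum
  refine tendsto_of_tendsto_of_tendsto_of_le_of_le tendsto_const_nhds hsum
    (fun k => zero_le) fun k => ?_
  rw [← lintegral_const_mul' _ _ (by simp), ← lintegral_add_left' (hhm k).enorm]
  refine lintegral_mono fun x => ?_
  have hC0 : 0 ≤ C := (abs_nonneg _).trans (hαC x)
  have heq : (α x * θ (wk k x) + β x * (θ' (wk k x) * pk k x)) -
      (α x * θ (w x) + β x * (θ' (w x) * p x)) =
      h k x + β x * θ' (wk k x) * (pk k x - p x) := by simp only [hh]; ring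
  rw [heq]
  refine (enorm_add_le _ _).trans (add_le_add le_rfl ?_)
  rw [enorm_mul]
  refine mul_le_mul_left ?_ _
  rw [← ofReal_norm, norm_mul]
  refine ENNReal.ofReal_le_ofReal ?_
  calc ‖β x‖ * ‖θ' (wk k x)‖ ≤ C * 1 :=
        mul_le_mul (hβC x) (hθ1' _) (norm_nonneg _) hC0
    _ = C := mul_one C

/-! ### Truncations extended by zero across the boundary -/

section Trace

variable {m N : ℕ} {Ω : Set (Vec (m + 1))}

lemma boundaryMeasure_eq (Ω : Set (Vec (m + 1))) :
    boundaryMeasure Ω = (Measure.hausdorffMeasure (m : ℝ)).restrict (frontier Ω) := by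
  unfold boundaryMeasure
  congr 2
  push_cast
  ring

/-- A weak gradient is only locally integrable by definition. Here it differs by an integrable
function from the gradient of some `v k`, which is bounded on the compact closure. -/
lemma integrableOn_of_tendsto_classicalGrad (hb : Bornology.IsBounded Ω)
    {G : Vec (m + 1) → Grad (m + 1) N} (hG : AEStronglyMeasurable G (volume.restrict Ω))
    {v : ℕ → Vec (m + 1) → Vec N}
    (hv : ∀ k, ContDiff ℝ ∞ (v k))
    (hvG : Tendsto (fun k => eLpNorm (fun x => classicalGrad (v k) x - G x) 1 (volume.restrict Ω))
      atTop (𝓝 0)) : IntegrableOn G Ω := by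
  obtain ⟨k, hk⟩ := (hvG.eventually (eventually_lt_nhds (show (0 : ℝ≥0∞) < ⊤ by simp))).exists
  have hc := continuous_classicalGrad (hv k)
  have h1 : IntegrableOn (classicalGrad (v k)) Ω :=
    (hc.continuousOn.integrableOn_compact hb.isCompact_closure).mono_set subset_closure
  have h2 : Integrable (fun x => classicalGrad (v k) x - G x) (volume.restrict Ω) :=
    memLp_one_iff_integrable.1 ⟨hc.aestronglyMeasurable.sub hG, hk⟩
  exact (Integrable.sub h1 h2).congr (Eventually.of_forall fun x => sub_sub_cancel _ _)

/-- The volume of the cylinder over the set of boundary points at which `⟪a, v_k⟫ ≥ b` tends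
to `0`, if the boundary values `g` satisfy `⟪a, g⟫ ≤ c < b`. -/
lemma tendsto_volume_cylinder (hb : Bornology.IsBounded Ω)
    {g : Vec (m + 1) → Vec N} (hgm : AEStronglyMeasurable g (boundaryMeasure Ω))
    {v : ℕ → Vec (m + 1) → Vec N} (hv : ∀ k, ContDiff ℝ ∞ (v k))
    (hvg : Tendsto (fun k => eLpNorm (fun x => v k x - g x) 1 (boundaryMeasure Ω)) atTop (𝓝 0))
    {a : Vec N} (ha : ‖a‖ ≤ 1) {b c : ℝ} (hbc : c < b)
    (hgc : ∀ᵐ x ∂(boundaryMeasure Ω), inner ℝ a (g x) ≤ c) (i : Fin (m + 1)) :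
    Tendsto (fun k => volume (Ω ∩ dropCoord i ⁻¹'
      (dropCoord i '' (frontier Ω ∩ {x | b ≤ inner ℝ a (v k x)})))) atTop (𝓝 0) := by
  obtain ⟨R, hR⟩ := hb.exists_norm_le
  set δ := ENNReal.ofReal (b - c) with hδ
  have hδ0 : δ ≠ 0 := (ENNReal.ofReal_pos.2 (sub_pos.2 hbc)).ne'
  have hlim : Tendsto (fun k => ENNReal.ofReal (2 * R) *
      (eLpNorm (fun x => v k x - g x) 1 (boundaryMeasure Ω) / δ)) atTop (𝓝 0) := by
    have h1 := ENNReal.Tendsto.div_const hvg (b := δ) (Or.inr hδ0)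
    rw [ENNReal.zero_div] at h1
    have h2 := ENNReal.Tendsto.const_mul (a := ENNReal.ofReal (2 * R)) h1
      (Or.inr ENNReal.ofReal_ne_top)
    rwa [mul_zero] at h2
  refine tendsto_of_tendsto_of_tendsto_of_le_of_le tendsto_const_nhds hlim
    (fun k => zero_le) fun k => ?_
  -- The cylinder has volume at most `2R` times that of its base, the base is dominated by the
  -- Hausdorff measure of the boundary set, and on that set `|v_k - g| ≥ b - c`, so Chebyshev
  -- applies.
  refine (volume_inter_cylinder_le hR i _).trans ?_
  refine mul_le_mul_right ((volume_image_dropCoord_le i _).trans ?_) _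
  have hcl : IsClosed {x : Vec (m + 1) | b ≤ inner ℝ a (v k x)} :=
    isClosed_le continuous_const (continuous_const.inner (hv k).continuous)
  rw [inter_comm, ← Measure.restrict_apply hcl.measurableSet, ← boundaryMeasure_eq,
    ENNReal.le_div_iff_mul_le (Or.inl hδ0) (Or.inl (by simp [hδ])), mul_comm]
  refine le_trans ?_ ((mul_meas_ge_le_lintegral₀ (f := fun x => ‖v k x - g x‖ₑ)
    ((hv k).continuous.aestronglyMeasurable.sub hgm).enorm δ).trans_eq
    eLpNorm_one_eq_lintegral_enorm.symm)
  refine mul_le_mul_right (measure_mono_ae ?_) _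
  filter_upwards [hgc] with x hx hxb
  have hxb : b ≤ inner ℝ a (v k x) := hxb
  change δ ≤ ‖v k x - g x‖ₑ
  rw [← ofReal_norm]
  refine ENNReal.ofReal_le_ofReal ?_
  have h1 := real_inner_le_norm a (v k x - g x)
  rw [inner_sub_right] at h1
  have h2 : ‖a‖ * ‖v k x - g x‖ ≤ 1 * ‖v k x - g x‖ := by gcongr
  linarith

/-- The truncation `θ(⟪a, u⟫ - b)` of `u`, extended by zero, is weakly differentiable across `∂Ω`
if the boundary values of `u` satisfy `⟪a, g⟫ ≤ c < b`. -/
lemma integral_truncation_eq_zero (hΩ : IsOpen Ω) (hb : Bornology.IsBounded Ω)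
    {u g : Vec (m + 1) → Vec N} {G : Vec (m + 1) → Grad (m + 1) N}
    (hum : AEStronglyMeasurable u (volume.restrict Ω)) (hG : IntegrableOn G Ω)
    (hgm : AEStronglyMeasurable g (boundaryMeasure Ω))
    {v : ℕ → Vec (m + 1) → Vec N} (hv : ∀ k, ContDiff ℝ ∞ (v k))
    (hvu : ∀ᵐ x ∂(volume.restrict Ω), Tendsto (fun k => v k x) atTop (𝓝 (u x)))
    (hvG : Tendsto (fun k => eLpNorm (fun x => classicalGrad (v k) x - G x) 1 (volume.restrict Ω))
      atTop (𝓝 0))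
    (hvg : Tendsto (fun k => eLpNorm (fun x => v k x - g x) 1 (boundaryMeasure Ω)) atTop (𝓝 0))
    {θ : ℝ → ℝ} (hθ : IsCutoff θ) {a : Vec N} (ha : ‖a‖ ≤ 1) {b c : ℝ} (hbc : c < b)
    (hgc : ∀ᵐ x ∂(boundaryMeasure Ω), inner ℝ a (g x) ≤ c)
    {ψ : Vec (m + 1) → ℝ} (hψ : ContDiff ℝ ∞ ψ) (hψc : HasCompactSupport ψ) (i : Fin (m + 1)) :
    ∫ x in Ω, (fderiv ℝ ψ x (EuclideanSpace.single i 1) * θ (inner ℝ a (u x) - b) +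
      ψ x * (deriv θ (inner ℝ a (u x) - b) * inner ℝ a (G x i))) = 0 := by
  have hfin : IsFiniteMeasure (volume.restrict Ω) :=
    isFiniteMeasure_restrict.2 hb.measure_lt_top.ne
  set e : Vec (m + 1) := EuclideanSpace.single i 1 with he
  set μ := volume.restrict Ω with hμ
  set D : Vec (m + 1) → ℝ := fun x => fderiv ℝ ψ x e * θ (inner ℝ a (u x) - b) +
      ψ x * (deriv θ (inner ℝ a (u x) - b) * inner ℝ a (G x i)) with hD
  -- `Dk k` is the `i`-th partial derivative of `ψ θ(⟪a, v_k⟫ - b)`, and `D` is its limit in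
  -- `L¹(Ω)`.
  set Dk : ℕ → Vec (m + 1) → ℝ := fun k x => fderiv ℝ ψ x e * θ (inner ℝ a (v k x) - b) +
      ψ x * (deriv θ (inner ℝ a (v k x) - b) * inner ℝ a (classicalGrad (v k) x i)) with hDk
  set E : ℕ → Set (Fin m → ℝ) := fun k =>
    dropCoord i '' (frontier Ω ∩ {x | b ≤ inner ℝ a (v k x)}) with hE
  have hψ' := contDiff_fderiv_apply hψ e
  obtain ⟨C₁, hC₁⟩ := hψc.exists_bound_of_continuous hψ.continuous
  obtain ⟨C₂, hC₂⟩ := (hψc.fderiv_apply ℝ e).exists_bound_of_continuous hψ'.continuous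
  have hθd : Continuous (deriv θ) := hθ.contDiff.continuous_deriv (by simp)
  have hθd1 : ∀ s, |deriv θ s| ≤ 1 := fun s => by
    rw [abs_of_nonneg (hθ.deriv_nonneg s)]; exact hθ.deriv_le_one s
  have hrow : Integrable (fun x => inner ℝ a (G x i)) μ :=
    ((rowCLM (m + 1) N i).integrable_comp hG).const_inner a
  have hwm : AEStronglyMeasurable (fun x => inner ℝ a (u x) - b) μ :=
    (aestronglyMeasurable_const.inner hum).sub aestronglyMeasurable_const
  have hpk : Tendsto (fun k => ∫⁻ x, ‖inner ℝ a (classicalGrad (v k) x i) -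
      inner ℝ a (G x i)‖ₑ ∂μ) atTop (𝓝 0) := by
    refine tendsto_of_tendsto_of_tendsto_of_le_of_le tendsto_const_nhds hvG
      (fun k => zero_le) fun k => ?_
    rw [eLpNorm_one_eq_lintegral_enorm]
    refine lintegral_mono fun x => ?_
    rw [← inner_sub_right, ← ofReal_norm, ← ofReal_norm]
    refine ENNReal.ofReal_le_ofReal ((norm_inner_le_norm _ _).trans ?_)
    have h1 := PiLp.norm_apply_le (classicalGrad (v k) x - G x) i
    rw [PiLp.sub_apply] at h1
    refine (mul_le_mul ha h1 (norm_nonneg _) zero_le_one).trans_eq (one_mul _)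
  have hconv : Tendsto (fun k => ∫⁻ x, ‖Dk k x - D x‖ₑ ∂μ) atTop (𝓝 0) := by
    refine tendsto_lintegral_chain_rule hθ.contDiff.continuous hθd hθ.abs_le_one hθd1
      hψ'.continuous.aestronglyMeasurable hψ.continuous.aestronglyMeasurable
      (C := max C₁ C₂) (fun x => (hC₂ x).trans (le_max_right _ _))
      (fun x => (hC₁ x).trans (le_max_left _ _)) hwm (fun k => ?_) hrow ?_ hpk
    · have := (hv k).continuous
      exact Continuous.aestronglyMeasurable (by fun_prop)
    · filter_upwards [hvu] with x hx
      exact (tendsto_const_nhds.inner hx).sub_const b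
  have hDi : Integrable D μ := by
    refine Integrable.add ?_ ?_
    · refine Integrable.of_bound (hψ'.continuous.aestronglyMeasurable.mul
        (hθ.contDiff.continuous.comp_aestronglyMeasurable hwm)) C₂ (Eventually.of_forall fun x => ?_)
      rw [norm_mul]
      exact (mul_le_mul (hC₂ x) (hθ.abs_le_one _) (abs_nonneg _)
        ((norm_nonneg _).trans (hC₂ x))).trans_eq (mul_one _)
    · refine (hrow.bdd_mul (c := 1) (hθd.comp_aestronglyMeasurable hwm)
        (Eventually.of_forall fun x => hθd1 _)).bdd_mul (c := C₁)
        hψ.continuous.aestronglyMeasurable (Eventually.of_forall hC₁)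
  have hDkc : ∀ k, Continuous (Dk k) := fun k => by
    have h1 := (hv k).continuous
    have h2 := (rowCLM (m + 1) N i).continuous.comp (continuous_classicalGrad (hv k))
    have h3 : Continuous fun x => classicalGrad (v k) x i := h2
    have h4 := hψ'.continuous
    have h5 := hψ.continuous
    have h6 := hθ.contDiff.continuous
    fun_prop
  have hDki : ∀ k, Integrable (Dk k) μ := fun k =>
    ((hDkc k).continuousOn.integrableOn_compact hb.isCompact_closure).mono_set subset_closure
  -- Where `⟪a, v_k⟫ < b` on the boundary, `θ(⟪a, v_k⟫ - b)` vanishes in a neighbourhood; only the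
  -- lines over `E k` contribute.
  have hcyl : ∀ k, ∫ x in Ω, Dk k x = ∫ x in Ω ∩ dropCoord i ⁻¹' E k, Dk k x := by
    intro k
    set f : Vec (m + 1) → ℝ := fun x => ψ x * θ (inner ℝ a (v k x) - b) with hf
    have hw : ContDiff ℝ ∞ fun x => inner ℝ a (v k x) - b :=
      (contDiff_const.inner ℝ (hv k)).sub contDiff_const
    have hfc : ContDiff ℝ ∞ f := hψ.mul (hθ.contDiff.comp hw)
    have hfd : ∀ x, fderiv ℝ f x e = Dk k x := by
      intro x
      have h1 : HasFDerivAt (fun x => inner ℝ a (v k x) - b)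
          ((innerSL ℝ a).comp (fderiv ℝ (v k) x)) x :=
        ((innerSL ℝ a).hasFDerivAt.comp x
          ((hv k).differentiable (by simp) x).hasFDerivAt).sub_const b
      have h2 := (hθ.contDiff.differentiable (by simp) (inner ℝ a (v k x) - b)).hasDerivAt
      have h3 := (h2.comp_hasFDerivAt x h1)
      have h4 := ((hψ.differentiable (by simp) x).hasFDerivAt).mul h3
      rw [show fderiv ℝ f x = _ from h4.fderiv]
      simp only [hDk, classicalGrad, _root_.add_apply, _root_.smul_apply, smul_eq_mul,
        Function.comp, ContinuousLinearMap.comp_apply, innerSL_apply_apply]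
      ring
    have hclosed : IsClosed {x : Vec (m + 1) | b ≤ inner ℝ a (v k x)} :=
      isClosed_le continuous_const (continuous_const.inner (hv k).continuous)
    have hfr : IsCompact (frontier Ω) :=
      hb.isCompact_closure.of_isClosed_subset isClosed_frontier frontier_subset_closure
    have hEm : MeasurableSet (E k) :=
      ((hfr.inter_right hclosed).image (lipschitzWith_dropCoord i).continuous).measurableSet
    have := setIntegral_fderiv_eq_setIntegral_cylinder hΩ hb (hfc.of_le (by simp)) i hEm (by
      intro x hx hxE
      have hlt : inner ℝ a (v k x) < b := by
        by_contra h
        exact hxE ⟨x, ⟨hx, not_lt.1 h⟩, rfl⟩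
      have hcw : ContinuousAt (fun x => inner ℝ a (v k x)) x :=
        (continuous_const.inner (hv k).continuous).continuousAt
      filter_upwards [hcw.eventually (eventually_lt_nhds hlt)] with y hy
      simp only [hf]
      rw [hθ.eq_zero _ (by linarith), mul_zero])
    simp only [← he, hfd] at this
    exact this
  have hlim1 : Tendsto (fun k => ∫ x, Dk k x ∂μ) atTop (𝓝 (∫ x, D x ∂μ)) :=
    tendsto_integral_of_L1 D hDi.1 (Eventually.of_forall hDki) hconv
  -- Absolute continuity of the integral of `D`, as the cylinders have vanishing volume.
  have hvol : Tendsto (fun k => ∫⁻ x in Ω ∩ dropCoord i ⁻¹' E k, ‖D x‖ₑ) atTop (𝓝 0) := by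
    have h1 := tendsto_volume_cylinder hb hgm hv hvg ha hbc hgc i
    have hEk : ∀ k, MeasurableSet (dropCoord i ⁻¹' E k) := fun k => by
      have hclosed : IsClosed {x : Vec (m + 1) | b ≤ inner ℝ a (v k x)} :=
        isClosed_le continuous_const (continuous_const.inner (hv k).continuous)
      have hfr : IsCompact (frontier Ω) :=
        hb.isCompact_closure.of_isClosed_subset isClosed_frontier frontier_subset_closure
      exact (lipschitzWith_dropCoord i).continuous.measurable
        ((hfr.inter_right hclosed).image (lipschitzWith_dropCoord i).continuous).measurableSet
    have h2 := tendsto_setLIntegral_zero (μ := μ) (f := fun x => ‖D x‖ₑ) hDi.2.ne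
      (s := fun k => dropCoord i ⁻¹' E k) (l := atTop) (h1.congr fun k => by
        rw [Function.comp, hμ, Measure.restrict_apply (hEk k), inter_comm])
    refine h2.congr fun k => ?_
    rw [hμ, Measure.restrict_restrict (hEk k), inter_comm]
  -- On the cylinder, `|Dk| ≤ |Dk - D| + |D|`, and both terms have vanishing integral.
  have hlim2 : Tendsto (fun k => ∫ x, Dk k x ∂μ) atTop (𝓝 0) := by
    rw [tendsto_zero_iff_enorm_tendsto_zero]
    have hsum := hconv.add hvol
    rw [add_zero] at hsum
    refine tendsto_of_tendsto_of_tendsto_of_le_of_le tendsto_const_nhds hsum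
      (fun k => zero_le) fun k => ?_
    change ‖∫ x in Ω, Dk k x‖ₑ ≤ _
    rw [hcyl k]
    refine (enorm_integral_le_lintegral_enorm _).trans ?_
    have hsub : volume.restrict (Ω ∩ dropCoord i ⁻¹' E k) ≤ μ :=
      Measure.restrict_mono inter_subset_left le_rfl
    calc ∫⁻ x in Ω ∩ dropCoord i ⁻¹' E k, ‖Dk k x‖ₑ
        ≤ ∫⁻ x in Ω ∩ dropCoord i ⁻¹' E k, (‖Dk k x - D x‖ₑ + ‖D x‖ₑ) := by
          refine lintegral_mono fun x => ?_
          simpa using enorm_add_le (Dk k x - D x) (D x)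
      _ = (∫⁻ x in Ω ∩ dropCoord i ⁻¹' E k, ‖Dk k x - D x‖ₑ) +
            ∫⁻ x in Ω ∩ dropCoord i ⁻¹' E k, ‖D x‖ₑ :=
          lintegral_add_left' (((hDki k).1.sub hDi.1).mono_measure hsub).enorm _
      _ ≤ _ := add_le_add (lintegral_mono' hsub le_rfl) le_rfl
  exact tendsto_nhds_unique hlim1 hlim2

end Trace

/-! ### Luxemburg norm and modular -/

section Luxemburg

variable {n : ℕ} {E : Type*} [NormedAddCommGroup E] [NormedSpace ℝ E] {φ : ℝ → ℝ}
  {Ω : Set (Vec n)} {f g : Vec n → E}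

lemma luxemburgNorm_le {l : ℝ} (hl : 0 < l)
    (h : scaledModular (fun t => φ (max t 0)) (volume.restrict Ω) l⁻¹ f ≤ 1) :
    luxemburgNorm φ Ω f ≤ ENNReal.ofReal l :=
  iInf₂_le l ⟨hl, by rwa [modular_smul_eq_scaledModular φ Ω f (inv_nonneg.2 hl.le)]⟩

lemma exists_scaledModular_le_one {δ : ℝ≥0∞} (h : luxemburgNorm φ Ω f < δ) :
    ∃ l : ℝ, 0 < l ∧ ENNReal.ofReal l < δ ∧
      scaledModular (fun t => φ (max t 0)) (volume.restrict Ω) l⁻¹ f ≤ 1 := by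
  unfold luxemburgNorm at h
  simp only [iInf_lt_iff] at h
  obtain ⟨l, ⟨hl, hm⟩, hlt⟩ := h
  exact ⟨l, hl, hlt, by rwa [modular_smul_eq_scaledModular φ Ω f (inv_nonneg.2 hl.le)] at hm⟩

lemma luxemburgNorm_congr (h : f =ᵐ[volume.restrict Ω] g) :
    luxemburgNorm φ Ω f = luxemburgNorm φ Ω g := by
  have : ∀ l : ℝ, modular φ Ω (fun x => l⁻¹ • f x) = modular φ Ω (fun x => l⁻¹ • g x) :=
    fun l => lintegral_congr_ae (h.mono fun x hx => by simp only [hx])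
  simp only [luxemburgNorm, this]

/-- Midpoint convexity at scale `(2l)⁻¹`, with `l` the larger of two admissible values, bounds the
modular of the sum by the average of two modulars at most `1`. This weak triangle inequality
suffices for approximation. -/
lemma luxemburgNorm_add_le (hΦ : IsDoublingYoung fun t => φ (max t 0))
    (hf : AEStronglyMeasurable f (volume.restrict Ω)) {δ : ℝ≥0∞} (h1 : luxemburgNorm φ Ω f < δ)
    (h2 : luxemburgNorm φ Ω g < δ) : luxemburgNorm φ Ω (fun x => f x + g x) ≤ 2 * δ := by
  obtain ⟨l₁, hl₁, hδ₁, hm₁⟩ := exists_scaledModular_le_one h1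
  obtain ⟨l₂, hl₂, hδ₂, hm₂⟩ := exists_scaledModular_le_one h2
  set Φ := fun t => φ (max t 0)
  set l := max l₁ l₂
  have hl : 0 < l := lt_max_of_lt_left hl₁
  have hlδ : ENNReal.ofReal l ≤ δ := by
    rw [ENNReal.ofReal_max]; exact max_le hδ₁.le hδ₂.le
  have hmono : ∀ {l' : ℝ} (v : Vec n → E), 0 < l' → l' ≤ l →
      scaledModular Φ (volume.restrict Ω) l⁻¹ v ≤ scaledModular Φ (volume.restrict Ω) l'⁻¹ v :=
    fun v h0 hle => lintegral_mono fun x => ENNReal.ofReal_le_ofReal (hΦ.monotone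
      (mul_le_mul_of_nonneg_right (inv_anti₀ h0 hle) (norm_nonneg _)))
  refine (luxemburgNorm_le (l := 2 * l) (by positivity) ?_).trans ?_
  · have hpt : ∀ x, ENNReal.ofReal (Φ ((2 * l)⁻¹ * ‖f x + g x‖)) ≤
        2⁻¹ * (ENNReal.ofReal (Φ (l⁻¹ * ‖f x‖)) + ENNReal.ofReal (Φ (l⁻¹ * ‖g x‖))) := by
      intro x
      have hf0 := hΦ.nonneg (t := l⁻¹ * ‖f x‖) (by positivity)
      have hg0 := hΦ.nonneg (t := l⁻¹ * ‖g x‖) (by positivity)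
      rw [← ENNReal.ofReal_add hf0 hg0,
        show (2⁻¹ : ℝ≥0∞) = ENNReal.ofReal 2⁻¹ by
          rw [ENNReal.ofReal_inv_of_pos two_pos]; simp,
        ← ENNReal.ofReal_mul (by norm_num)]
      refine ENNReal.ofReal_le_ofReal ?_
      have h3 := hΦ.map_add_le ((2 * l)⁻¹ * ‖f x‖) ((2 * l)⁻¹ * ‖g x‖)
      have h4 : Φ ((2 * l)⁻¹ * ‖f x + g x‖) ≤
          Φ ((2 * l)⁻¹ * ‖f x‖ + (2 * l)⁻¹ * ‖g x‖) := hΦ.monotone (by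
        rw [← mul_add]; gcongr; exact norm_add_le _ _)
      have h5 : ∀ s : ℝ, 2 * ((2 * l)⁻¹ * s) = l⁻¹ * s := fun s => by field_simp
      rw [h5, h5] at h3
      exact (h4.trans h3).trans_eq (by ring)
    refine (lintegral_mono hpt).trans ?_
    rw [lintegral_const_mul' _ _ (by simp), lintegral_add_left' (hΦ.aemeasurable_comp hf _)]
    have h6 := add_le_add ((hmono f hl₁ (le_max_left _ _)).trans hm₁)
      ((hmono g hl₂ (le_max_right _ _)).trans hm₂)
    refine (mul_le_mul_right h6 2⁻¹).trans_eq ?_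
    rw [one_add_one_eq_two, ENNReal.inv_mul_cancel (by simp) (by simp)]
  · rw [ENNReal.ofReal_mul zero_le_two, ENNReal.ofReal_ofNat]
    gcongr

end Luxemburg

/-! ### The competitor and its gradient -/

section Competitor

variable {n N : ℕ} {Ω : Set (Vec n)} {φ : ℝ → ℝ} {f F : Vec n → Vec N} {H : Vec n → Grad n N}

lemma MemOrlicz.scaledModular_lt_top {E : Type*} [NormedAddCommGroup E] [NormedSpace ℝ E]
    {w : Vec n → E} (hΦ : IsDoublingYoung fun t => φ (max t 0)) (h : MemOrlicz φ Ω w) (l : ℝ) :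
    scaledModular (fun t => φ (max t 0)) (volume.restrict Ω) l w < ⊤ := by
  obtain ⟨l', hl', hm⟩ := h.2
  rw [modular_smul_eq_scaledModular φ Ω w (inv_nonneg.2 hl'.le)] at hm
  exact hΦ.scaledModular_lt_top (inv_pos.2 hl') hm l

lemma memOrlicz_of_scaledModular_lt_top {E : Type*} [NormedAddCommGroup E] [NormedSpace ℝ E]
    {w : Vec n → E} (hw : LocallyIntegrableOn w Ω)
    (h : scaledModular (fun t => φ (max t 0)) (volume.restrict Ω) 1 w < ⊤) : MemOrlicz φ Ω w :=
  ⟨hw, 1, one_pos, by rwa [modular_smul_eq_scaledModular φ Ω w (by norm_num), inv_one]⟩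

lemma MemOrlicz.add {E : Type*} [NormedAddCommGroup E] [NormedSpace ℝ E]
    {w w' : Vec n → E} (hΦ : IsDoublingYoung fun t => φ (max t 0)) (h : MemOrlicz φ Ω w)
    (h' : MemOrlicz φ Ω w') : MemOrlicz φ Ω (fun x => w x + w' x) :=
  memOrlicz_of_scaledModular_lt_top (h.1.add h'.1)
    ((hΦ.scaledModular_add_le zero_le_one h.1.aestronglyMeasurable w').trans_lt
      (ENNReal.add_lt_top.2 ⟨h.scaledModular_lt_top hΦ _, h'.scaledModular_lt_top hΦ _⟩))

lemma MemOrlicz.congr {E : Type*} [NormedAddCommGroup E] [NormedSpace ℝ E]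
    {w w' : Vec n → E} (h : MemOrlicz φ Ω w) (hw : w =ᵐ[volume.restrict Ω] w') :
    MemOrlicz φ Ω w' := by
  obtain ⟨h1, l, hl, hm⟩ := h
  refine ⟨h1.congr hw, l, hl, lt_of_eq_of_lt ?_ hm⟩
  exact lintegral_congr_ae (hw.symm.mono fun x hx => by simp only [hx])

lemma MemW.hasWeakGrad (h : MemW φ Ω f) : HasWeakGrad Ω f (weakGrad Ω f) := by
  obtain ⟨G, hG⟩ := h.1
  exact hG.weakGrad

lemma MemW.add (hΦ : IsDoublingYoung fun t => φ (max t 0)) (hΩ : IsOpen Ω) {f' : Vec n → Vec N}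
    (h : MemW φ Ω f) (h' : MemW φ Ω f') : MemW φ Ω (fun x => f x + f' x) := by
  have hg := h.hasWeakGrad.add h'.hasWeakGrad
  exact ⟨⟨_, hg⟩, h.2.1.add hΦ h'.2.1, (h.2.2.add hΦ h'.2.2).congr (hg.weakGrad_ae_eq hΩ).symm⟩

namespace IsZeroExtension

lemma neg {Φ : ℝ → ℝ} (h : IsZeroExtension Φ Ω F H) :
    IsZeroExtension Φ Ω (fun x => -F x) (fun x => -H x) where
  hasWeakGrad := h.hasWeakGrad.neg
  integrable := h.integrable.neg
  integrable_grad := h.integrable_grad.neg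
  modular_lt_top := by simpa only [scaledModular, norm_neg] using h.modular_lt_top
  modular_grad_lt_top := by simpa only [scaledModular, norm_neg] using h.modular_grad_lt_top
  eq_zero x hx := by rw [h.eq_zero x hx, neg_zero]

lemma scaledModular_restrict_le {E : Type*} [NormedAddCommGroup E] (Φ : ℝ → ℝ) (l : ℝ)
    (w : Vec n → E) : scaledModular Φ (volume.restrict Ω) l w ≤ scaledModular Φ volume l w :=
  lintegral_mono' Measure.restrict_le_self le_rfl

lemma memW (hΩ : IsOpen Ω) (h : IsZeroExtension (fun t => φ (max t 0)) Ω F H) :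
    MemW φ Ω F := by
  have hg : HasWeakGrad Ω F H := h.hasWeakGrad.of_univ
  refine ⟨⟨H, hg⟩, memOrlicz_of_scaledModular_lt_top hg.1
    ((scaledModular_restrict_le _ _ _).trans_lt h.modular_lt_top), ?_⟩
  exact (memOrlicz_of_scaledModular_lt_top hg.2.1
    ((scaledModular_restrict_le _ _ _).trans_lt h.modular_grad_lt_top)).congr
      (hg.weakGrad_ae_eq hΩ).symm

lemma memWZero_add (hΦ : IsDoublingYoung fun t => φ (max t 0)) (hΩ : IsBoundedLipschitzDomain Ω)
    (h : IsZeroExtension (fun t => φ (max t 0)) Ω F H) (hf : MemWZero φ Ω f) :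
    MemWZero φ Ω (fun x => f x + F x) := by
  refine ⟨hf.1.add hΦ hΩ.isOpen (h.memW hΩ.isOpen), fun ε hε => ?_⟩
  obtain ⟨r, hr0, hrε⟩ := ENNReal.lt_iff_exists_nnreal_btwn.1 hε
  have hr0 : 0 < r := by exact_mod_cast hr0
  -- Four norms are made smaller than `δ`: two of functions, two of gradients. Adding within each
  -- pair costs `2 * δ`, in total `r < ε`.
  set δ : ℝ≥0 := r / 4 with hδ
  have hδ0 : 0 < δ := by positivity
  obtain ⟨ψ₁, hψ₁, hc₁, hs₁, hn₁⟩ := hf.2 δ (by exact_mod_cast hδ0)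
  -- Modular at most `1` at scale `(δ / 2)⁻¹` means Luxemburg norm at most `δ / 2`, which is
  -- strictly below `δ`.
  obtain ⟨ψ₂, hψ₂, hc₂, hs₂, hm, hmg⟩ := h.isApproximable hΦ hΩ ((δ / 2 : ℝ)⁻¹)
    (by positivity) 1 one_pos
  have hlt : ENNReal.ofReal (δ / 2 : ℝ) < δ := by
    rw [← ENNReal.ofReal_coe_nnreal, ENNReal.ofReal_lt_ofReal_iff (by exact_mod_cast hδ0)]
    have : (0 : ℝ) < δ := by exact_mod_cast hδ0
    linarith
  have hδ2 : (0 : ℝ) < δ / 2 := by positivity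
  have n₁ : luxemburgNorm φ Ω (fun x => f x - ψ₁ x) < δ := lt_of_le_of_lt le_self_add hn₁
  have ng₁ : luxemburgNorm φ Ω (weakGrad Ω fun x => f x - ψ₁ x) < δ :=
    lt_of_le_of_lt le_add_self hn₁
  have n₂ : luxemburgNorm φ Ω (fun x => F x - ψ₂ x) < δ :=
    (luxemburgNorm_le hδ2 ((scaledModular_restrict_le _ _ _).trans hm)).trans_lt hlt
  have ng₂ : luxemburgNorm φ Ω (fun x => H x - classicalGrad ψ₂ x) < δ :=
    (luxemburgNorm_le hδ2 ((scaledModular_restrict_le _ _ _).trans hmg)).trans_lt hlt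
  have w₁ : HasWeakGrad Ω (fun x => f x - ψ₁ x) (weakGrad Ω fun x => f x - ψ₁ x) :=
    (hf.1.hasWeakGrad.sub (hasWeakGrad_classicalGrad hψ₁)).weakGrad
  have w₂ : HasWeakGrad Ω (fun x => F x - ψ₂ x) (fun x => H x - classicalGrad ψ₂ x) :=
    h.hasWeakGrad.of_univ.sub (hasWeakGrad_classicalGrad hψ₂)
  refine ⟨fun x => ψ₁ x + ψ₂ x, hψ₁.add hψ₂, hc₁.add hc₂,
    (tsupport_add ψ₁ ψ₂).trans (union_subset hs₁ hs₂), lt_of_le_of_lt ?_ hrε⟩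
  have heq : (fun x => f x + F x - (ψ₁ x + ψ₂ x)) = fun x => (f x - ψ₁ x) + (F x - ψ₂ x) :=
    funext fun x => add_sub_add_comm _ _ _ _
  rw [heq, sobolevNorm, luxemburgNorm_congr ((w₁.add w₂).weakGrad_ae_eq hΩ.isOpen)]
  refine (add_le_add (luxemburgNorm_add_le hΦ w₁.1.aestronglyMeasurable n₁ n₂)
    (luxemburgNorm_add_le hΦ w₁.2.1.aestronglyMeasurable ng₁ ng₂)).trans_eq ?_
  have : r = 2 * δ + 2 * δ := by rw [hδ]; ring
  rw [this]
  push_cast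
  rfl

end IsZeroExtension

/-- The gradient of the truncation `θ(⟪a, u⟫ - b) a`. -/
noncomputable def truncationGrad (θ : ℝ → ℝ) (a : Vec N) (b : ℝ) (u : Vec n → Vec N)
    (G : Vec n → Grad n N) (x : Vec n) : Grad n N :=
  WithLp.toLp 2 fun i => (deriv θ (inner ℝ a (u x) - b) * inner ℝ a (G x i)) • a

variable {θ : ℝ → ℝ} {a : Vec N} {b : ℝ} {u : Vec n → Vec N} {G : Vec n → Grad n N}

/-- In each row, with `s = θ'` and `p = ⟪a, ∂ᵢu⟫`, the left side equals `|∂ᵢu|² - 2s(1 - s)p²`, and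
`0 ≤ s ≤ 1`. Keeping `|T|²` on the left makes equality of energies force `T = 0`. -/
lemma norm_sub_truncationGrad_sq_add_le (hθ : IsCutoff θ) (ha : ‖a‖ = 1) (x : Vec n) :
    ‖G x - truncationGrad θ a b u G x‖ ^ 2 + ‖truncationGrad θ a b u G x‖ ^ 2 ≤ ‖G x‖ ^ 2 := by
  rw [PiLp.norm_sq_eq_of_L2, PiLp.norm_sq_eq_of_L2, PiLp.norm_sq_eq_of_L2,
    ← Finset.sum_add_distrib]
  refine Finset.sum_le_sum fun i _ => ?_
  rw [PiLp.sub_apply]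
  set s := deriv θ (inner ℝ a (u x) - b)
  set p := inner ℝ a (G x i)
  have hs0 : 0 ≤ s := hθ.deriv_nonneg _
  have hs1 : s ≤ 1 := hθ.deriv_le_one _
  change ‖G x i - (s * p) • a‖ ^ 2 + ‖(s * p) • a‖ ^ 2 ≤ _
  rw [norm_sub_sq_real, inner_smul_right, real_inner_comm, norm_smul, ha, mul_one,
    Real.norm_eq_abs, sq_abs]
  change _ - 2 * (s * p * p) + _ + _ ≤ _
  nlinarith [mul_nonneg (mul_nonneg hs0 (sub_nonneg.2 hs1)) (sq_nonneg p)]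

lemma norm_truncationGrad_le (hθ : IsCutoff θ) (ha : ‖a‖ = 1) (x : Vec n) :
    ‖truncationGrad θ a b u G x‖ ≤ ‖G x‖ := by
  refine le_of_sq_le_sq ?_ (norm_nonneg _)
  have := norm_sub_truncationGrad_sq_add_le (b := b) (u := u) (G := G) hθ ha x
  nlinarith [sq_nonneg ‖G x - truncationGrad θ a b u G x‖]

lemma norm_sub_truncationGrad_le (hθ : IsCutoff θ) (ha : ‖a‖ = 1) (x : Vec n) :
    ‖G x - truncationGrad θ a b u G x‖ ≤ ‖G x‖ := by
  refine le_of_sq_le_sq ?_ (norm_nonneg _)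
  have := norm_sub_truncationGrad_sq_add_le (b := b) (u := u) (G := G) hθ ha x
  nlinarith [sq_nonneg ‖truncationGrad θ a b u G x‖]

lemma aestronglyMeasurable_truncationGrad {μ : Measure (Vec n)} (hθ : IsCutoff θ)
    (hu : AEStronglyMeasurable u μ) (hG : AEStronglyMeasurable G μ) :
    AEStronglyMeasurable (truncationGrad θ a b u G) μ := by
  have hθd : Continuous (deriv θ) := hθ.contDiff.continuous_deriv (by simp)
  have h1 : AEStronglyMeasurable (fun x => deriv θ (inner ℝ a (u x) - b)) μ :=
    hθd.comp_aestronglyMeasurable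
      ((aestronglyMeasurable_const.inner hu).sub aestronglyMeasurable_const)
  have h2 : ∀ i, AEMeasurable
      (fun x => (deriv θ (inner ℝ a (u x) - b) * inner ℝ a (G x i)) • a) μ := fun i =>
    ((h1.mul (aestronglyMeasurable_const.inner
      ((rowCLM n N i).continuous.comp_aestronglyMeasurable hG))).smul_const a).aemeasurable
  exact ((WithLp.measurable_toLp 2 (Fin n → Vec N)).comp_aemeasurable
    (aemeasurable_pi_iff.2 h2)).aestronglyMeasurable

lemma IsDoublingYoung.scaledModular_indicator {Φ : ℝ → ℝ} (hΦ : IsDoublingYoung Φ) {E : Type*}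
    [NormedAddCommGroup E] (hΩ : MeasurableSet Ω) (l : ℝ) (w : Vec n → E) :
    scaledModular Φ volume l (Ω.indicator w) = scaledModular Φ (volume.restrict Ω) l w := by
  unfold scaledModular
  rw [← lintegral_indicator hΩ]
  refine lintegral_congr fun x => ?_
  by_cases hx : x ∈ Ω
  · rw [indicator_of_mem hx, indicator_of_mem hx]
  · rw [indicator_of_notMem hx, indicator_of_notMem hx]
    simp [hΦ.map_zero]

end Competitor

/-! ### From half-spaces to the convex hull -/

section Main

variable {m N : ℕ} {Ω : Set (Vec (m + 1))} {φ : ℝ → ℝ}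

/-- `integral_truncation_eq_zero` times the vector `a` gives the weak gradient on `ℝⁿ`. The bounds
follow from `|θ| ≤ 1` on a set of finite measure and from `|T| ≤ |G|`. -/
lemma isZeroExtension_truncation {Φ : ℝ → ℝ} (hΦ : IsDoublingYoung Φ) (hΩ : IsOpen Ω)
    (hb : Bornology.IsBounded Ω)
    {u g : Vec (m + 1) → Vec N} {G : Vec (m + 1) → Grad (m + 1) N}
    (hum : AEStronglyMeasurable u (volume.restrict Ω)) (hG : IntegrableOn G Ω)
    (hGΦ : scaledModular Φ (volume.restrict Ω) 1 G < ⊤)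
    (hgm : AEStronglyMeasurable g (boundaryMeasure Ω))
    {v : ℕ → Vec (m + 1) → Vec N} (hv : ∀ k, ContDiff ℝ ∞ (v k))
    (hvu : ∀ᵐ x ∂(volume.restrict Ω), Tendsto (fun k => v k x) atTop (𝓝 (u x)))
    (hvG : Tendsto (fun k => eLpNorm (fun x => classicalGrad (v k) x - G x) 1 (volume.restrict Ω))
      atTop (𝓝 0))
    (hvg : Tendsto (fun k => eLpNorm (fun x => v k x - g x) 1 (boundaryMeasure Ω)) atTop (𝓝 0))
    {θ : ℝ → ℝ} (hθ : IsCutoff θ) {a : Vec N} (ha : ‖a‖ = 1) {b c : ℝ} (hbc : c < b)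
    (hgc : ∀ᵐ x ∂(boundaryMeasure Ω), inner ℝ a (g x) ≤ c) :
    IsZeroExtension Φ Ω (Ω.indicator fun x => θ (inner ℝ a (u x) - b) • a)
      (Ω.indicator (truncationGrad θ a b u G)) := by
  have hfin : IsFiniteMeasure (volume.restrict Ω) :=
    isFiniteMeasure_restrict.2 hb.measure_lt_top.ne
  have hwm : AEStronglyMeasurable (fun x => inner ℝ a (u x) - b) (volume.restrict Ω) :=
    (aestronglyMeasurable_const.inner hum).sub aestronglyMeasurable_const
  have hFn : ∀ x, ‖θ (inner ℝ a (u x) - b) • a‖ ≤ 1 := fun x => by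
    rw [norm_smul, ha, mul_one]; exact hθ.abs_le_one _
  have hFm : AEStronglyMeasurable (fun x => θ (inner ℝ a (u x) - b) • a) (volume.restrict Ω) :=
    (hθ.contDiff.continuous.comp_aestronglyMeasurable hwm).smul_const a
  have hFi : Integrable (Ω.indicator fun x => θ (inner ℝ a (u x) - b) • a) :=
    (integrable_indicator_iff hΩ.measurableSet).2
      (Integrable.of_bound hFm 1 (Eventually.of_forall hFn))
  have hHm : AEStronglyMeasurable (truncationGrad θ a b u G) (volume.restrict Ω) :=
    aestronglyMeasurable_truncationGrad hθ hum hG.1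
  have hHi : Integrable (Ω.indicator (truncationGrad θ a b u G)) :=
    (integrable_indicator_iff hΩ.measurableSet).2
      (Integrable.mono hG hHm (Eventually.of_forall (norm_truncationGrad_le hθ ha)))
  refine ⟨⟨hFi.locallyIntegrable.locallyIntegrableOn _,
    hHi.locallyIntegrable.locallyIntegrableOn _, fun ψ hψ hψc _ i => ?_⟩, hFi, hHi, ?_, ?_,
    fun x hx => indicator_of_notMem hx _⟩
  · have key := integral_truncation_eq_zero hΩ hb hum hG hgm hv hvu hvG hvg hθ ha.le hbc hgc
      hψ hψc i
    have e1 : ∀ x, fderiv ℝ ψ x (EuclideanSpace.single i 1) •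
        Ω.indicator (fun x => θ (inner ℝ a (u x) - b) • a) x = Ω.indicator (fun x =>
          (fderiv ℝ ψ x (EuclideanSpace.single i 1) * θ (inner ℝ a (u x) - b)) • a) x :=
      fun x => by
        by_cases hx : x ∈ Ω
        · rw [indicator_of_mem hx, indicator_of_mem hx, smul_smul]
        · rw [indicator_of_notMem hx, indicator_of_notMem hx, smul_zero]
    have e2 : ∀ x, ψ x • Ω.indicator (truncationGrad θ a b u G) x i = Ω.indicator (fun x =>
          (ψ x * (deriv θ (inner ℝ a (u x) - b) * inner ℝ a (G x i))) • a) x :=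
      fun x => by
        by_cases hx : x ∈ Ω
        · rw [indicator_of_mem hx, indicator_of_mem hx, mul_smul]
          rfl
        · rw [indicator_of_notMem hx, indicator_of_notMem hx, PiLp.zero_apply, smul_zero]
    simp only [setIntegral_univ, e1, e2]
    rw [integral_indicator hΩ.measurableSet, integral_indicator hΩ.measurableSet,
      eq_neg_iff_add_eq_zero, integral_smul_const, integral_smul_const, ← add_smul,
      ← integral_add, key, zero_smul]
    · obtain ⟨C, hC⟩ := (hψc.fderiv_apply ℝ
        (EuclideanSpace.single i 1)).exists_bound_of_continuous
        (contDiff_fderiv_apply hψ (EuclideanSpace.single i 1)).continuous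
      exact (Integrable.of_bound (hθ.contDiff.continuous.comp_aestronglyMeasurable hwm) 1
        (Eventually.of_forall fun x => hθ.abs_le_one _)).bdd_mul (c := C)
        (contDiff_fderiv_apply hψ _).continuous.aestronglyMeasurable (Eventually.of_forall hC)
    · obtain ⟨C, hC⟩ := hψc.exists_bound_of_continuous hψ.continuous
      have hrow : Integrable (fun x => inner ℝ a (G x i)) (volume.restrict Ω) :=
        ((rowCLM (m + 1) N i).integrable_comp hG).const_inner a
      have hθd : Continuous (deriv θ) := hθ.contDiff.continuous_deriv (by simp)
      exact (hrow.bdd_mul (c := 1) (hθd.comp_aestronglyMeasurable hwm)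
        (Eventually.of_forall fun x => by
          rw [Real.norm_of_nonneg (hθ.deriv_nonneg _)]; exact hθ.deriv_le_one _)).bdd_mul
        (c := C) hψ.continuous.aestronglyMeasurable (Eventually.of_forall hC)
  · rw [hΦ.scaledModular_indicator hΩ.measurableSet]
    refine (hΦ.scaledModular_mono_ae (g := fun _ => (1 : ℝ)) zero_le_one
      (Eventually.of_forall fun x => by simpa using hFn x)).trans_lt ?_
    simp only [scaledModular, lintegral_const]
    exact ENNReal.mul_lt_top ENNReal.ofReal_lt_top (measure_lt_top _ _)
  · rw [hΦ.scaledModular_indicator hΩ.measurableSet]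
    exact (hΦ.scaledModular_mono_ae zero_le_one
      (Eventually.of_forall (norm_truncationGrad_le hθ ha))).trans_lt hGΦ

lemma energy_eq (hΩ : IsOpen Ω) {v : Vec (m + 1) → Vec N} {G : Vec (m + 1) → Grad (m + 1) N}
    (h : HasWeakGrad Ω v G) :
    energy φ Ω v = scaledModular (fun t => φ (max t 0)) (volume.restrict Ω) 1 G := by
  rw [← IsDoublingYoung.scaledModular_congr (h.weakGrad_ae_eq hΩ),
    ← modular_smul_eq_scaledModular φ Ω _ zero_le_one]
  simp [energy]

/-- Half-spaces containing the boundary values of a minimizer contain the minimizer. -/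
lemma ae_inner_le_of_boundary (hφ : IsNFunction φ) (hφc : IsStrictlyConvex φ)
    (hq : upperSimonenkoIndex φ < ⊤) (hΩ : IsBoundedLipschitzDomain Ω)
    {uD u g : Vec (m + 1) → Vec N} (huD : MemW φ Ω uD)
    (hu : IsHarmonicWithBoundaryValues φ Ω uD u) (hg : IsTrace Ω u g)
    {a : Vec N} (ha : ‖a‖ = 1) {b c : ℝ} (hbc : c < b)
    (hgc : ∀ᵐ x ∂(boundaryMeasure Ω), inner ℝ a (g x) ≤ c) :
    ∀ᵐ x ∂(volume.restrict Ω), inner ℝ a (u x) ≤ b := by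
  have hΦ := hφ.isDoublingYoung hφc hq
  set Φ := fun t => φ (max t 0) with hΦdef
  obtain ⟨hgL, G, hG, v, hv, hvu, hvG, hvg⟩ := hg
  have hGi := integrableOn_of_tendsto_classicalGrad hΩ.isBounded hG.2.1.aestronglyMeasurable hv hvG
  -- Convergence in `L¹` gives almost everywhere convergence along a subsequence, as the truncation
  -- argument requires.
  obtain ⟨ns, hns, hae⟩ := (tendstoInMeasure_of_tendsto_eLpNorm one_ne_zero
    (fun k => (hv k).continuous.aestronglyMeasurable) hG.1.aestronglyMeasurable
    hvu).exists_seq_tendsto_ae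
  have huW : MemW φ Ω u := by
    have := hu.1.1.add hΦ hΩ.isOpen huD
    simpa only [sub_add_cancel] using this
  have hGΦ : scaledModular Φ (volume.restrict Ω) 1 G < ⊤ := by
    rw [← IsDoublingYoung.scaledModular_congr (hG.weakGrad_ae_eq hΩ.isOpen)]
    exact huW.2.2.scaledModular_lt_top hΦ 1
  obtain ⟨θ, hθ⟩ := exists_isCutoff
  have hZ := isZeroExtension_truncation hΦ hΩ.isOpen hΩ.isBounded hG.1.aestronglyMeasurable hGi
    hGΦ hgL.1 (fun k => hv (ns k)) hae (hvG.comp hns.tendsto_atTop) (hvg.comp hns.tendsto_atTop)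
    hθ ha hbc hgc
  set F := Ω.indicator fun x => θ (inner ℝ a (u x) - b) • a with hF
  set T := truncationGrad θ a b u G with hT
  have hcomp : MemWZero φ Ω (fun x => (u x - F x) - uD x) := by
    have := hZ.neg.memWZero_add hΦ hΩ hu.1
    simpa only [← sub_eq_add_neg, sub_right_comm] using this
  have hTΩ : Ω.indicator T =ᵐ[volume.restrict Ω] T :=
    indicator_ae_eq_restrict hΩ.isOpen.measurableSet
  have hgv : HasWeakGrad Ω (fun x => u x - F x) (fun x => G x - T x) :=
    (hG.sub hZ.hasWeakGrad.of_univ).congr (ae_eq_refl _)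
      (hTΩ.mono fun x hx => by simp only [hx])
  have hmin := hu.2 _ hcomp
  rw [energy_eq hΩ.isOpen hG, energy_eq hΩ.isOpen hgv] at hmin
  have hle := hΦ.scaledModular_mono_ae (μ := volume.restrict Ω) zero_le_one
    (Eventually.of_forall (norm_sub_truncationGrad_le (b := b) (u := u) (G := G) hθ ha))
  -- The densities are ordered pointwise and minimality orders their finite integrals the other way,
  -- so they agree almost everywhere.
  have heq := ae_eq_of_ae_le_of_lintegral_le (μ := volume.restrict Ω)
    (f := fun x => ENNReal.ofReal (Φ (1 * ‖G x - T x‖)))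
    (g := fun x => ENNReal.ofReal (Φ (1 * ‖G x‖)))
    (Eventually.of_forall fun x => ENNReal.ofReal_le_ofReal (hΦ.monotone
      (mul_le_mul_of_nonneg_left (norm_sub_truncationGrad_le hθ ha x) zero_le_one)))
    (hle.trans_lt hGΦ).ne (hΦ.aemeasurable_comp hGi.1 1) hmin
  have hT0 : T =ᵐ[volume.restrict Ω] 0 := by
    filter_upwards [heq] with x hx
    rw [ENNReal.ofReal_eq_ofReal_iff (hΦ.nonneg (by positivity)) (hΦ.nonneg (by positivity)),
      hΦdef] at hx
    simp only [one_mul, max_eq_left (norm_nonneg _)] at hx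
    -- Strict monotonicity gives `|G - T| = |G|`, and the quadratic inequality leaves `|T|² ≤ 0`.
    have hn := (hφ.strictMonoOn hφc).injOn (mem_Ici.2 (norm_nonneg _))
      (mem_Ici.2 (norm_nonneg _)) hx
    have h1 := norm_sub_truncationGrad_sq_add_le (b := b) (u := u) (G := G) hθ ha x
    rw [← hT, hn] at h1
    have h2 : ‖T x‖ ^ 2 = 0 := le_antisymm (by linarith) (sq_nonneg _)
    simpa using h2
  have hH0 : Ω.indicator T =ᵐ[volume] 0 := by
    rw [EventuallyEq, ae_restrict_iff' hΩ.isOpen.measurableSet] at hT0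
    filter_upwards [hT0] with x hx
    by_cases hxΩ : x ∈ Ω
    · rw [indicator_of_mem hxΩ, hx hxΩ]
    · rw [indicator_of_notMem hxΩ]; rfl
  -- The weak gradient vanishes on all of `ℝⁿ`, not just on `Ω`, so the bounded support excludes
  -- nonzero constants.
  have hF0 : F =ᵐ[volume] 0 :=
    (hZ.hasWeakGrad.congr (ae_eq_refl _) (by rwa [Measure.restrict_univ])
      ).ae_eq_zero_of_grad_zero hZ.integrable hΩ.isBounded.isCompact_closure
      fun x hx => hZ.eq_zero x fun h => hx (subset_closure h)
  rw [ae_restrict_iff' hΩ.isOpen.measurableSet]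
  filter_upwards [hF0] with x hx hxΩ
  by_contra hlt
  have hpos := hθ.pos (inner ℝ a (u x) - b) (by linarith [not_le.1 hlt])
  rw [hF, indicator_of_mem hxΩ] at hx
  rcases smul_eq_zero.1 hx with h | h
  · exact hpos.ne' h
  · rw [h, norm_zero] at ha; exact zero_ne_one ha

lemma exists_halfSpace_of_notMem {X : Type*} [MeasurableSpace X] {μ : Measure X} (hμ : μ ≠ 0)
    {g : X → Vec N} {K : Set (Vec N)} (hK : Convex ℝ K) (hKc : IsClosed K)
    (hg : ∀ᵐ x ∂μ, g x ∈ K) {y : Vec N} (hy : y ∉ K) :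
    ∃ a : Vec N, ∃ c : ℝ, ‖a‖ = 1 ∧ (∀ᵐ x ∂μ, inner ℝ a (g x) ≤ c) ∧ c < inner ℝ a y := by
  obtain ⟨f, s, hf, hs⟩ := geometric_hahn_banach_closed_point hK hKc hy
  have : (ae μ).NeBot := ae_neBot.2 hμ
  -- A point of `K` is needed for the separating functional to be nonzero; it exists because `μ ≠
  -- 0`.
  obtain ⟨x, hx⟩ := hg.exists
  set w := (InnerProductSpace.toDual ℝ (Vec N)).symm f
  have hw : ∀ z, inner ℝ w z = f z := fun z => InnerProductSpace.toDual_symm_apply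
  have hw0 : 0 < ‖w‖ := by
    refine norm_pos_iff.2 fun h => ?_
    have h1 := (hf _ hx).trans hs
    rw [← hw, ← hw, h, inner_zero_left, inner_zero_left] at h1
    exact lt_irrefl _ h1
  have hin : ∀ z, inner ℝ (‖w‖⁻¹ • w) z = ‖w‖⁻¹ * f z := fun z => by
    rw [real_inner_smul_left, hw]
  refine ⟨‖w‖⁻¹ • w, ‖w‖⁻¹ * s, ?_, ?_, ?_⟩
  · rw [norm_smul, norm_inv, norm_norm, inv_mul_cancel₀ hw0.ne']
  · filter_upwards [hg] with x hx
    rw [hin]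
    exact mul_le_mul_of_nonneg_left (hf _ hx).le (by positivity)
  · rw [hin]
    exact mul_lt_mul_of_pos_left hs (by positivity)

/-- Points outside the hull lie in open half-spaces that `u` avoids almost everywhere. There are
uncountably many of these, but by the Lindelöf property countably many have the same union. -/
lemma ae_mem_boundaryConvexHull (hφ : IsNFunction φ) (hφc : IsStrictlyConvex φ)
    (hq : upperSimonenkoIndex φ < ⊤) (hΩ : IsBoundedLipschitzDomain Ω)
    {uD u g : Vec (m + 1) → Vec N} (huD : MemW φ Ω uD)
    (hu : IsHarmonicWithBoundaryValues φ Ω uD u) (hg : IsTrace Ω u g) :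
    ∀ᵐ x ∂(volume.restrict Ω), u x ∈ boundaryConvexHull Ω g := by
  have hμ := boundaryMeasure_ne_zero hΩ.isOpen hΩ.isConnected.nonempty hΩ.isBounded
  -- The triples are `(a, c, b)`; the gap `c < b` is the one required by `ae_inner_le_of_boundary`.
  let ι := {p : Vec N × ℝ × ℝ // ‖p.1‖ = 1 ∧ p.2.1 < p.2.2 ∧
    ∀ᵐ x ∂(boundaryMeasure Ω), inner ℝ p.1 (g x) ≤ p.2.1}
  let U : ι → Set (Vec N) := fun p => {y | p.1.2.2 < inner ℝ p.1.1 y}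
  have hU : ∀ p, IsOpen (U p) := fun p =>
    isOpen_lt continuous_const (continuous_const.inner continuous_id)
  obtain ⟨T, hT, hTU⟩ := TopologicalSpace.isOpen_iUnion_countable U hU
  have hall : ∀ᵐ x ∂(volume.restrict Ω), ∀ p ∈ T, u x ∉ U p := by
    rw [ae_ball_iff hT]
    intro p _
    filter_upwards [ae_inner_le_of_boundary hφ hφc hq hΩ huD hu hg p.2.1 p.2.2.1 p.2.2.2] with x hx
    exact not_lt.2 hx
  filter_upwards [hall] with x hx
  rintro K ⟨hK, hKc, hKg⟩
  by_contra hxK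
  obtain ⟨a, c, ha, hac, hlt⟩ := exists_halfSpace_of_notMem hμ hK hKc hKg hxK
  obtain ⟨b, hcb, hb⟩ := exists_between hlt
  have hmem : u x ∈ ⋃ p, U p := mem_iUnion.2 ⟨⟨(a, c, b), ha, hcb, hac⟩, hb⟩
  rw [← hTU] at hmem
  obtain ⟨p, hp, hpx⟩ := mem_iUnion₂.1 hmem
  exact hx p hp hpx

/-- If finite, the essential supremum of `|g|` is the radius of a closed ball that is one of the
convex sets defining the hull. -/
lemma eLpNorm_top_le_of_mem_boundaryConvexHull {u g : Vec (m + 1) → Vec N}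
    (h : ∀ᵐ x ∂(volume.restrict Ω), u x ∈ boundaryConvexHull Ω g) :
    eLpNorm u ⊤ (volume.restrict Ω) ≤ eLpNorm g ⊤ (boundaryMeasure Ω) := by
  by_cases htop : eLpNorm g ⊤ (boundaryMeasure Ω) = ⊤
  · rw [htop]; exact le_top
  set M := eLpNorm g ⊤ (boundaryMeasure Ω) with hM
  have hball : ∀ y : Vec N, y ∈ Metric.closedBall 0 M.toReal ↔ ‖y‖ₑ ≤ M := fun y => by
    rw [mem_closedBall_zero_iff, ← ofReal_norm, ENNReal.ofReal_le_iff_le_toReal htop]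
  have hK : Metric.closedBall 0 M.toReal ∈ {K : Set (Vec N) | Convex ℝ K ∧ IsClosed K ∧
      ∀ᵐ x ∂(boundaryMeasure Ω), g x ∈ K} := by
    refine ⟨convex_closedBall _ _, Metric.isClosed_closedBall, ?_⟩
    filter_upwards [ae_le_eLpNormEssSup (f := g) (μ := boundaryMeasure Ω)] with x hx
    rw [hball, hM, eLpNorm_exponent_top]
    exact hx
  rw [eLpNorm_exponent_top]
  refine essSup_le_of_ae_le _ ?_
  filter_upwards [h] with x hx
  exact (hball _).1 (hx _ hK)

end Main

end OrliczSobolev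

theorem lemma4p1 {n N : ℕ} (hn : 1 ≤ n)
    (φ : ℝ → ℝ) (hφ : OrliczSobolev.IsNFunction φ) (hφc : OrliczSobolev.IsStrictlyConvex φ)
    (hp : 1 ≤ OrliczSobolev.lowerSimonenkoIndex φ) (hq : OrliczSobolev.upperSimonenkoIndex φ < ⊤)
    (Ω : Set (OrliczSobolev.Vec n)) (hΩ : OrliczSobolev.IsBoundedLipschitzDomain Ω)
    (uD u : OrliczSobolev.Vec n → OrliczSobolev.Vec N) (huD : OrliczSobolev.MemW φ Ω uD)
    (hu : OrliczSobolev.IsHarmonicWithBoundaryValues φ Ω uD u)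
    (g : OrliczSobolev.Vec n → OrliczSobolev.Vec N) (hg : OrliczSobolev.IsTrace Ω u g) :
    (∀ᵐ x ∂(volume.restrict Ω), u x ∈ OrliczSobolev.boundaryConvexHull Ω g) ∧
      eLpNorm u ⊤ (volume.restrict Ω) ≤ eLpNorm g ⊤ (OrliczSobolev.boundaryMeasure Ω) := by
  -- Writing `n = m + 1` allows one coordinate to be split off.
  obtain ⟨m, rfl⟩ : ∃ m, n = m + 1 := ⟨n - 1, by omega⟩
  have h := OrliczSobolev.ae_mem_boundaryConvexHull hφ hφc hq hΩ huD hu hg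
  exact ⟨h, OrliczSobolev.eLpNorm_top_le_of_mem_boundaryConvexHull h⟩
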